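/- Let $n\ge 2$, write $x=(x_1,x_2)\in\mathbb R^{2n}$ with $x_1,x_2\in\mathbb R^n$, let $B_1$ be the open unit ball of $\mathbb R^{2n}$, and set $$w(x)=\frac{1}{\sqrt2}\,\frac{|x_2|^2-|x_1|^2}{|x|}\quad(x\ne0),\qquad w(0)=0 .$$ Then there is a function $F:\mathbb R^{2n}\to\mathbb R$ which is $C^1$ and uniformly convex (i.e. $F-\frac m2|\cdot|^2$ is convex for some $m>0$) such that the following hold. 1. Let $D_F:=\mathbb R^{2n}\setminus\bigcup_{k>1}\{k^{-1}I<D^2F<kI\}$ be the degeneracy set of $F$, where $\{k^{-1}I<D^2F<kI\}$ is the set of points at which $\nabla F$ is differentiable and $k^{-1}|\xi|^2<D^2F(\xi,\xi)<k|\xi|^2$ for all $\xi\neq0$. Then $$D_F=\{p=(p_1,p_2)\in\mathbb R^{2n}:\ |p_1|=|p_2|\}\cap\sqrt2\,S^{2n-1},$$ and $F\in C^\infty(\mathbb R^{2n}\setminus D_F)$. 2. $w\in W^{1,\infty}(B_1)$ is a weak solution of the Euler–Lagrange equation $\operatorname{div}(\nabla F(\nabla w))=0$ in $B_1$, that is,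 $\int_{B_1}\nabla F(\nabla w)\cdot\nabla\varphi\,dx=0$ for every $\varphi\in C^1(B_1)$ with compact support in $B_1$. 3. $w$ is a minimizer: $\int_{B_1}F(\nabla w)\,dx\le\int_{B_1}F(\nabla w+\nabla\varphi)\,dx$ for every $\varphi\in C^1(B_1)$ with compact support in $B_1$. Moreover $w$ is Lipschitz on $\mathbb R^{2n}$ but is not $C^1$ in $B_1$. (For $n=2$ this is a singular Lipschitz minimizer in $\mathbb R^4$ with a strictly convex integrand.) -/

import Mathlib

open MeasureTheory Set Metric
open scoped ContDiff Gradient RealInnerProductSpace NNReal ENNReal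

noncomputable section

/-- `ℝ²ⁿ = ℝⁿ × ℝⁿ` with its Euclidean norm. The two halves of `x = (x₁, x₂)` are
`x.fst` and `x.snd`. -/
abbrev DoubleSpace (n : ℕ) : Type :=
  WithLp 2 (EuclideanSpace ℝ (Fin n) × EuclideanSpace ℝ (Fin n))

section General

variable {E : Type*} [NormedAddCommGroup E] [InnerProductSpace ℝ E] [FiniteDimensional ℝ E]
  [MeasurableSpace E] [BorelSpace E]

/-- `φ` is a compactly supported `C^k` function on the open set `U`, extended by zero. -/
structure IsTestFunction (k : ℕ∞) (U : Set E) (φ : E → ℝ) : Prop where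
  contDiff : ContDiff ℝ k φ
  hasCompactSupport : HasCompactSupport φ
  tsupport_subset : tsupport φ ⊆ U

/-- `g` is a weak (distributional) gradient of `u` on the open set `U`. -/
structure IsWeakGradient (U : Set E) (u : E → ℝ) (g : E → E) : Prop where
  locallyIntegrableOn : LocallyIntegrableOn u U volume
  locallyIntegrableOn_grad : LocallyIntegrableOn g U volume
  integral_eq : ∀ φ : E → ℝ, IsTestFunction ⊤ U φ → ∀ v : E,
    ∫ x in U, u x * fderiv ℝ φ x v = - ∫ x in U, φ x * ⟪g x, v⟫

/-- Weak gradients on open sets are unique up to null sets. -/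
theorem IsWeakGradient.ae_eq {U : Set E} (hU : IsOpen U) {u : E → ℝ} {g h : E → E}
    (hg : IsWeakGradient U u g) (hh : IsWeakGradient U u h) :
    g =ᵐ[volume.restrict U] h := by
  have hloc : LocallyIntegrableOn (fun x => g x - h x) U volume :=
    hg.locallyIntegrableOn_grad.sub hh.locallyIntegrableOn_grad
  have key : ∀ᵐ x ∂(volume : Measure E), x ∈ U → g x - h x = 0 := by
    refine hU.ae_eq_zero_of_integral_contDiff_smul_eq_zero hloc ?_
    intro φ hφ hc hs
    have ht : IsTestFunction ⊤ U φ := ⟨hφ, hc, hs⟩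
    have hint : ∀ f : E → E, LocallyIntegrableOn f U volume →
        Integrable (fun x => φ x • f x) volume := by
      intro f hf
      have hK : IntegrableOn f (tsupport φ) volume :=
        hf.integrableOn_compact_subset hs hc
      have h2 : IntegrableOn (fun x => φ x • f x) (tsupport φ) volume :=
        hK.continuousOn_smul hφ.continuous.continuousOn hc
      refine (integrableOn_iff_integrable_of_support_subset ?_).1 h2
      intro x hx
      apply subset_tsupport φ
      intro h0
      exact hx (by simp [h0])
    have hz : ∀ f : E → E, ∀ v : E, LocallyIntegrableOn f U volume →
        ∫ x in U, φ x * ⟪f x, v⟫ = ⟪v, ∫ x, φ x • f x⟫ := by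
      intro f v hf
      rw [← integral_inner (hint f hf), setIntegral_eq_integral_of_forall_compl_eq_zero]
      · congr 1
        ext x
        rw [inner_smul_right, real_inner_comm]
      · intro x hx
        have : φ x = 0 := image_eq_zero_of_notMem_tsupport fun h' => hx (hs h')
        simp [this]
    have hsub : ∫ x, φ x • (g x - h x) = (∫ x, φ x • g x) - ∫ x, φ x • h x := by
      simp only [smul_sub]
      exact integral_sub (hint g hg.locallyIntegrableOn_grad)
        (hint h hh.locallyIntegrableOn_grad)
    rw [hsub]
    refine ext_inner_left ℝ fun v => ?_
    rw [inner_sub_right, inner_zero_right, ← hz g v hg.locallyIntegrableOn_grad,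
      ← hz h v hh.locallyIntegrableOn_grad]
    have h1 := hg.integral_eq φ ht v
    have h2 := hh.integral_eq φ ht v
    linarith
  rw [Filter.EventuallyEq, ae_restrict_iff' hU.measurableSet]
  filter_upwards [key] with x hx hxU
  exact sub_eq_zero.1 (hx hxU)

open Classical in
/-- The weak gradient of `u` on `U` (zero if there is none). By `IsWeakGradient.ae_eq` it does
not depend, up to null sets, on the choice made. -/
def weakGrad (U : Set E) (u : E → ℝ) : E → E :=
  if h : ∃ g, IsWeakGradient U u g then h.choose else 0

/-- The Sobolev space `W^{1,∞}(U)`. -/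
def MemW1Infty (U : Set E) (u : E → ℝ) : Prop :=
  MemLp u ∞ (volume.restrict U) ∧
    ∃ g : E → E, IsWeakGradient U u g ∧ MemLp g ∞ (volume.restrict U)

/-- The functional `E(u) = ∫_{B₁} F(∇u) dx`. -/
def energy (F : E → ℝ) (u : E → ℝ) : ℝ :=
  ∫ x in ball (0 : E) 1, F (weakGrad (ball (0 : E) 1) u x)

/-- `u` is a Lipschitz minimizer of `∫_{B₁} F(∇u) dx`: `u ∈ W^{1,∞}(B₁)` and
`E(u) ≤ E(u + φ)` for all `φ ∈ C¹₀(B₁)`. -/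
def IsLipschitzMinimizer (F : E → ℝ) (u : E → ℝ) : Prop :=
  MemW1Infty (ball (0 : E) 1) u ∧
    ∀ φ : E → ℝ, IsTestFunction 1 (ball (0 : E) 1) φ → energy F u ≤ energy F (u + φ)

/-- `u ∈ W^{1,∞}(B₁)` solves `div(∇F(∇u)) = 0` in `B₁` in the weak sense. -/
def IsLipschitzWeakSolution (F : E → ℝ) (u : E → ℝ) : Prop :=
  MemW1Infty (ball (0 : E) 1) u ∧
    ∀ φ : E → ℝ, IsTestFunction 1 (ball (0 : E) 1) φ →
      ∫ x in ball (0 : E) 1, ⟪∇ F (weakGrad (ball (0 : E) 1) u x), ∇ φ x⟫ = 0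

end General

section Degeneracy

variable {E : Type*} [NormedAddCommGroup E] [InnerProductSpace ℝ E]

/-- The set `{k⁻¹ I < D²F < k I}` of the points at which `F` has a second derivative whose
quadratic form lies strictly between those of `k⁻¹ I` and `k I`. -/
def hessianPinched (F : E → ℝ) (k : ℝ) : Set E :=
  {p | DifferentiableAt ℝ (fderiv ℝ F) p ∧ ∀ ξ : E, ξ ≠ 0 →
    k⁻¹ * ‖ξ‖ ^ 2 < fderiv ℝ (fderiv ℝ F) p ξ ξ ∧ fderiv ℝ (fderiv ℝ F) p ξ ξ < k * ‖ξ‖ ^ 2}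

/-- The degeneracy set `D_F`, the complement of `⋃_{k > 1} {k⁻¹ I < D²F < k I}`. -/
def degeneracySet (F : E → ℝ) : Set E :=
  (⋃ k ∈ Ioi (1 : ℝ), hessianPinched F k)ᶜ

end Degeneracy

/-- `w(x) = (|x₂|² - |x₁|²) / (√2 |x|)`, with `w(0) = 0`. -/
def coneFunction (n : ℕ) (x : DoubleSpace n) : ℝ :=
  (‖x.snd‖ ^ 2 - ‖x.fst‖ ^ 2) / (√2 * ‖x‖)

end

/-!
The function `w = coneFunction n` is positively homogeneous of degree one, so `∇w` is homogeneous of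
degree zero. Write `J (x₁, x₂) = (-x₁, x₂)` and `z = ⟨x, J x⟩ / (2 |x|²)`. Then
`∇w = √2 (J x - z x) / |x|`. Let `s` and `t` be `(|x₂| - |x₁|) / (√2 |x|)` and
`(|x₂| + |x₁|) / (√2 |x|)`, so that `s² + t² = 1` and `s t = z`. The norms `P, Q` of the two halves
of `∇w` satisfy `(Q - P) / 2 = s³` and `(Q + P) / 2 = t³`: in these coordinates the gradients of `w`
trace an arc of an astroid, and the degeneracy set comes from its cusps.

The integrand is a function of `P` and `Q` only. The field
`X = (n - 1/2) (5 - 4 z²) J x / |x| + z (9 - 20 z²) x / |x|` is bounded and divergence free off the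
origin (`trace_fderiv_coneField`), hence everywhere in the weak sense
(`integral_inner_gradient_eq_zero`). So it suffices that `∇F (∇w) = X / √2`, which in the rotated
coordinates `((Q - P) / 2, (Q + P) / 2)` prescribes the gradient of a planar function along the
astroid: it must carry `(s³, t³)` to `(v s, v t)` for one explicit odd polynomial `v`
(`gradient_integrand_gradient_normCone`).

The polynomial `v` is a diffeomorphism of `[-1, 1]` onto its image, but `s³ ↦ v s` is not
differentiable at `0`; its inverse, however, is smooth. The planar function is therefore constructed
as a Legendre transform. Let `j` be a smooth odd inverse of `v s - s³ / 10`, extended to the line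
(`exists_inverse_profile`). The dual potential has gradient `(j₁³, j₂³)` plus a multiple of the
gradient of a function of `σ = j₁² + j₂²` whose derivative vanishes to second order at `σ = 1`. The
perturbation does not alter the gradient on the curve `σ = 1` and makes the Hessian positive except
at the four points of that curve with `j₁ j₂ = 0`. Its Legendre transform `G` is convex, `C¹`, and
smooth off the four cusps, where its gradient is not differentiable (`exists_planar_integrand`).

Substituting the norms into `G` and adding `|p|² / 40`, which restores the term `s³ / 10` and makes
the convexity uniform, gives `F` (`exists_integrand`). As `G` is even in `P` and in `Q`, convexity
survives the substitution, and so does smoothness, by Whitney's theorem on even functions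
(`contDiff_comp_norm_norm_of_even`). That `w` minimizes follows from the weak equation by convexity.
-/

/-! ### Smoothness of even functions of a norm -/

open Filter Topology in
/-- Differentiation under the integral sign over a compact interval, for a `C¹` integrand. -/
theorem hasFDerivAt_intervalIntegral_of_contDiff {P W : Type} [NormedAddCommGroup P]
    [NormedSpace ℝ P] [FiniteDimensional ℝ P] [NormedAddCommGroup W] [NormedSpace ℝ W]
    [CompleteSpace W] {f : ℝ × P → W} (hf : ContDiff ℝ 1 f) (x₀ : P) :
    HasFDerivAt (fun x => ∫ t in (0 : ℝ)..1, f (t, x))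
      (∫ t in (0 : ℝ)..1, (fderiv ℝ f (t, x₀)).comp (ContinuousLinearMap.inr ℝ ℝ P)) x₀ := by
  have hF' : Continuous fun q : ℝ × P =>
      (fderiv ℝ f q).comp (ContinuousLinearMap.inr ℝ ℝ P) :=
    (hf.continuous_fderiv one_ne_zero).clm_comp continuous_const
  have hK : IsCompact (Icc (0 : ℝ) 1 ×ˢ closedBall x₀ 1) :=
    isCompact_Icc.prod (isCompact_closedBall x₀ 1)
  obtain ⟨C, hC⟩ := (hK.image_of_continuousOn hF'.norm.continuousOn).bddAbove
  refine intervalIntegral.hasFDerivAt_integral_of_dominated_of_fderiv_le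
    (F := fun x t => f (t, x))
    (F' := fun x t => (fderiv ℝ f (t, x)).comp (ContinuousLinearMap.inr ℝ ℝ P))
    (s := closedBall x₀ 1) (bound := fun _ => C) (closedBall_mem_nhds x₀ one_pos) ?_ ?_ ?_ ?_ ?_ ?_
  · refine Eventually.of_forall fun x => Continuous.aestronglyMeasurable ?_
    exact hf.continuous.comp (by fun_prop)
  · exact (hf.continuous.comp
      (by fun_prop : Continuous fun t : ℝ => (t, x₀))).intervalIntegrable _ _
  · exact (hF'.comp (by fun_prop : Continuous fun t : ℝ => (t, x₀))).aestronglyMeasurable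
  · refine Eventually.of_forall fun t ht x hx => hC ⟨(t, x), ⟨?_, hx⟩, rfl⟩
    rw [uIoc_of_le zero_le_one] at ht
    exact ⟨ht.1.le, ht.2⟩
  · exact intervalIntegrable_const
  · refine Eventually.of_forall fun t _ x _ => ?_
    have h1 : HasFDerivAt (fun x : P => (t, x)) (ContinuousLinearMap.inr ℝ ℝ P) x :=
      hasFDerivAt_prodMk_right t x
    exact ((hf.differentiable one_ne_zero (t, x)).hasFDerivAt).comp x h1

/-- Integrals over a compact interval depend smoothly on parameters. -/
theorem contDiff_intervalIntegral_nat {P : Type} [NormedAddCommGroup P]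
    [NormedSpace ℝ P] [FiniteDimensional ℝ P] (k : ℕ) :
    ∀ {W : Type} [NormedAddCommGroup W] [NormedSpace ℝ W] [CompleteSpace W] {f : ℝ × P → W},
      ContDiff ℝ ∞ f → ContDiff ℝ k (fun x => ∫ t in (0 : ℝ)..1, f (t, x)) := by
  induction k with
  | zero =>
    intro W _ _ _ f hf
    have h : Continuous (fun x => ∫ t in (0 : ℝ)..1, f (t, x)) :=
      continuous_iff_continuousAt.2 fun x =>
        (hasFDerivAt_intervalIntegral_of_contDiff (hf.of_le (by simp)) x).continuousAt
    rw [Nat.cast_zero]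
    exact contDiff_zero.2 h
  | succ k ih =>
    intro W _ _ _ f hf
    push_cast
    rw [contDiff_succ_iff_hasFDerivAt]
    refine ⟨_, ?_, fun x =>
      hasFDerivAt_intervalIntegral_of_contDiff (hf.of_le (by simp)) x⟩
    apply ih (f := fun q : ℝ × P => (fderiv ℝ f q).comp (ContinuousLinearMap.inr ℝ ℝ P))
    exact (hf.fderiv_right (m := ∞) (by norm_cast)).clm_comp contDiff_const

theorem contDiff_intervalIntegral {P W : Type} [NormedAddCommGroup P]
    [NormedSpace ℝ P] [FiniteDimensional ℝ P] [NormedAddCommGroup W] [NormedSpace ℝ W]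
    [CompleteSpace W] {f : ℝ × P → W} (hf : ContDiff ℝ ∞ f) :
    ContDiff ℝ ∞ (fun x => ∫ t in (0 : ℝ)..1, f (t, x)) :=
  contDiff_infty.2 fun k => contDiff_intervalIntegral_nat k hf

section EvenNorm

variable {V P : Type} [NormedAddCommGroup V] [InnerProductSpace ℝ V]
  [NormedAddCommGroup P] [NormedSpace ℝ P]

theorem fderiv_fst_even {W : Type} [NormedAddCommGroup W] [NormedSpace ℝ W]
    {f : ℝ × P → W} (hf : Differentiable ℝ f)
    (he : ∀ r g, f (-r, g) = f (r, g)) (r : ℝ) (g : P) :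
    fderiv ℝ f (-r, g) (1, 0) = - fderiv ℝ f (r, g) (1, 0) := by
  have h1 : HasDerivAt (fun s : ℝ => f (s, g)) (fderiv ℝ f (r, g) (1, 0)) r :=
    (hf (r, g)).hasFDerivAt.comp_hasDerivAt r ((hasDerivAt_id r).prodMk (hasDerivAt_const r g))
  have h2 : HasDerivAt (fun s : ℝ => f (-s, g)) (fderiv ℝ f (-r, g) (-1, 0)) r :=
    (hf (-r, g)).hasFDerivAt.comp_hasDerivAt r ((hasDerivAt_neg r).prodMk (hasDerivAt_const r g))
  simp only [he] at h2
  have h3 := h1.unique h2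
  have h4 : ((-1 : ℝ), (0 : P)) = -((1 : ℝ), (0 : P)) := by simp
  rw [h4, map_neg] at h3
  rw [h3, neg_neg]

/-- Hadamard's lemma for even functions: `∂f/∂r = r f₁` with `f₁` smooth and again even. -/
theorem exists_smooth_div_of_even [FiniteDimensional ℝ P] {W : Type}
    [NormedAddCommGroup W] [NormedSpace ℝ W]
    [CompleteSpace W] {f : ℝ × P → W} (hf : ContDiff ℝ ∞ f)
    (he : ∀ r g, f (-r, g) = f (r, g)) :
    ∃ f₁ : ℝ × P → W, ContDiff ℝ ∞ f₁ ∧ (∀ r g, f₁ (-r, g) = f₁ (r, g)) ∧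
      ∀ r g, fderiv ℝ f (r, g) (1, 0) = r • f₁ (r, g) := by
  set D : ℝ × P → W := fun q => fderiv ℝ f q (1, 0) with hD
  have hDs : ContDiff ℝ ∞ D := (hf.fderiv_right (m := ∞) (by norm_cast)).clm_apply contDiff_const
  have hodd : ∀ r g, D (-r, g) = - D (r, g) := fderiv_fst_even (hf.differentiable (by simp)) he
  set E : ℝ × P → W := fun q => fderiv ℝ D q (1, 0) with hE
  have hEs : ContDiff ℝ ∞ E := (hDs.fderiv_right (m := ∞) (by norm_cast)).clm_apply contDiff_const
  have hDder : ∀ r g, HasDerivAt (fun s : ℝ => D (s, g)) (E (r, g)) r := fun r g =>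
    HasFDerivAt.comp_hasDerivAt (f := fun s : ℝ => (s, g)) r
      (hDs.differentiable (by simp) (r, g)).hasFDerivAt
      ((hasDerivAt_id r).prodMk (hasDerivAt_const r g))
  have hEeven : ∀ r g, E (-r, g) = E (r, g) := by
    intro r g
    have h1 : HasDerivAt (fun s : ℝ => D (-s, g)) ((-1 : ℝ) • E (-r, g)) r :=
      (hDder (-r) g).scomp r (hasDerivAt_neg r)
    simp only [hodd] at h1
    have h2 := (hDder r g).neg.unique h1
    simpa using h2.symm
  refine ⟨fun q => ∫ t in (0 : ℝ)..1, E (t * q.1, q.2), ?_, ?_, ?_⟩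
  · exact contDiff_intervalIntegral (f := fun q : ℝ × (ℝ × P) => E (q.1 * q.2.1, q.2.2))
      (hEs.comp (by fun_prop))
  · intro r g
    simp only [mul_neg, hEeven]
  · intro r g
    have hD0 : D (0, g) = 0 := by
      have := hodd 0 g
      rw [neg_zero] at this
      have h2 : (2 : ℝ) • D (0, g) = 0 := by rw [two_smul]; nth_rewrite 1 [this]; simp
      simpa using h2
    have key : ∀ t ∈ uIcc (0 : ℝ) 1,
        HasDerivAt (fun t : ℝ => D (t * r, g)) (r • E (t * r, g)) t := by
      intro t _
      have := HasDerivAt.scomp (g₁ := fun s : ℝ => D (s, g)) t (hDder (t * r) g)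
        ((hasDerivAt_id t).mul_const r)
      rw [one_mul] at this
      exact this
    have hint : IntervalIntegrable (fun t : ℝ => r • E (t * r, g)) volume 0 1 := by
      apply Continuous.intervalIntegrable
      exact continuous_const.smul (hEs.continuous.comp (by fun_prop))
    have h3 := intervalIntegral.integral_eq_sub_of_hasDerivAt key hint
    rw [intervalIntegral.integral_smul] at h3
    simp only [one_mul, zero_mul, hD0, sub_zero] at h3
    exact h3.symm

/-- Chain rule for `(y, g) ↦ f (‖y‖, g)`, with `f` even in its first variable. It also holds
at `y = 0`, where the norm is not differentiable. -/
theorem hasFDerivAt_comp_norm_of_even {W : Type} [NormedAddCommGroup W] [NormedSpace ℝ W]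
    {f f₁ : ℝ × P → W} (hf : Differentiable ℝ f)
    (h₁ : ∀ r g, fderiv ℝ f (r, g) (1, 0) = r • f₁ (r, g)) (q : V × P) :
    HasFDerivAt (fun q : V × P => f (‖q.1‖, q.2))
      (((innerSL ℝ q.1).comp (ContinuousLinearMap.fst ℝ V P)).smulRight (f₁ (‖q.1‖, q.2)) +
        (fderiv ℝ f (‖q.1‖, q.2)).comp
          ((ContinuousLinearMap.inr ℝ ℝ P).comp (ContinuousLinearMap.snd ℝ V P))) q := by
  obtain ⟨y, g⟩ := q
  have hsplit : ∀ (a : ℝ) (b : P) (r : ℝ), fderiv ℝ f (r, g) (a, b) =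
      (a * r) • f₁ (r, g) + fderiv ℝ f (r, g) (0, b) := by
    intro a b r
    have : (a, b) = a • ((1 : ℝ), (0 : P)) + (0, b) := by simp
    rw [this, map_add, map_smul, h₁, smul_smul]
  by_cases hy : y = 0
  · subst hy
    have hfd := (hf (‖(0 : V)‖, g)).hasFDerivAt
    rw [hasFDerivAt_iff_isLittleO] at hfd ⊢
    have hlim : Filter.Tendsto (fun q : V × P => (‖q.1‖, q.2)) (nhds ((0 : V), g))
        (nhds (‖(0 : V)‖, g)) := by
      apply Continuous.tendsto' (by fun_prop)
      simp
    have h2 := hfd.comp_tendsto hlim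
    refine (h2.congr_left ?_).trans_isBigO ?_
    · rintro ⟨v, w⟩
      have h5 : (‖v‖, w) - (‖(0 : V)‖, g) = (‖v‖, w - g) := by simp
      simp only [Function.comp, h5]
      rw [norm_zero, hsplit]
      simp
    · refine Asymptotics.IsBigO.of_bound 1 (Filter.Eventually.of_forall ?_)
      rintro ⟨v, w⟩
      simp [Prod.norm_def]
  · have hn : HasFDerivAt (fun y : V => ‖y‖) ((‖y‖⁻¹ : ℝ) • innerSL ℝ y) y := by
      have h := (hasStrictFDerivAt_norm_sq y).hasFDerivAt.sqrt (by positivity)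
      simp only [Real.sqrt_sq (norm_nonneg _)] at h
      convert h using 1
      ext v
      simp
      field_simp
    have h3 : HasFDerivAt (fun q : V × P => (‖q.1‖, q.2))
        ((((‖y‖⁻¹ : ℝ) • innerSL ℝ y).comp (ContinuousLinearMap.fst ℝ V P)).prod
          (ContinuousLinearMap.snd ℝ V P)) (y, g) :=
      HasFDerivAt.prodMk (HasFDerivAt.comp (y, g) (g := fun y : V => ‖y‖) hn hasFDerivAt_fst)
        hasFDerivAt_snd
    have h4 := ((hf (‖y‖, g)).hasFDerivAt).comp (y, g) h3
    refine h4.congr_fderiv ?_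
    ext v
    · have : ‖y‖ ≠ 0 := norm_ne_zero_iff.2 hy
      simp only [ContinuousLinearMap.comp_apply, ContinuousLinearMap.prod_apply,
        ContinuousLinearMap.inl_apply, ContinuousLinearMap.coe_fst', ContinuousLinearMap.coe_snd',
        add_apply, ContinuousLinearMap.smulRight_apply,
        smul_apply, ContinuousLinearMap.inr_apply]
      rw [hsplit]
      congr 2
      simp only [smul_eq_mul]
      field_simp
    · simp

/-- A smooth function of `(r, g)` that is even in `r` is smooth as a function of `(y, g)` upon
setting `r = ‖y‖`. -/
theorem contDiff_comp_norm_of_even_nat [FiniteDimensional ℝ P] (k : ℕ) :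
    ∀ {W : Type} [NormedAddCommGroup W] [NormedSpace ℝ W] [CompleteSpace W] {f : ℝ × P → W},
      ContDiff ℝ ∞ f → (∀ r g, f (-r, g) = f (r, g)) →
      ContDiff ℝ k (fun q : V × P => f (‖q.1‖, q.2)) := by
  induction k with
  | zero =>
    intro W _ _ _ f hf _
    exact contDiff_zero.2 (hf.continuous.comp (by fun_prop))
  | succ k ih =>
    intro W _ _ _ f hf he
    obtain ⟨f₁, hf₁, he₁, h₁⟩ := exists_smooth_div_of_even hf he
    push_cast
    rw [contDiff_succ_iff_hasFDerivAt]
    refine ⟨_, ?_, fun q => hasFDerivAt_comp_norm_of_even (hf.differentiable (by simp)) h₁ q⟩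
    have hA : ContDiff ℝ k (fun q : V × P => f₁ (‖q.1‖, q.2)) := ih hf₁ he₁
    have hB : ContDiff ℝ k (fun q : V × P =>
        (fderiv ℝ f (‖q.1‖, q.2)).comp (ContinuousLinearMap.inr ℝ ℝ P)) := by
      apply ih (f := fun q : ℝ × P => (fderiv ℝ f q).comp (ContinuousLinearMap.inr ℝ ℝ P))
      · exact (hf.fderiv_right (m := ∞) (by norm_cast)).clm_comp contDiff_const
      · intro r g
        ext b
        have h1 : HasFDerivAt (fun x : P => f (-r, x))
            ((fderiv ℝ f (-r, g)).comp (ContinuousLinearMap.inr ℝ ℝ P)) g :=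
          ((hf.differentiable (by simp) (-r, g)).hasFDerivAt).comp g (hasFDerivAt_prodMk_right _ _)
        have h2 : HasFDerivAt (fun x : P => f (r, x))
            ((fderiv ℝ f (r, g)).comp (ContinuousLinearMap.inr ℝ ℝ P)) g :=
          ((hf.differentiable (by simp) (r, g)).hasFDerivAt).comp g (hasFDerivAt_prodMk_right _ _)
        simp only [he] at h1
        rw [h1.unique h2]
    refine ContDiff.add ?_ ?_
    · refine ContDiff.smulRight ?_ hA
      exact ((innerSL ℝ (E := V)).contDiff.comp contDiff_fst).clm_comp contDiff_const
    · exact hB.clm_comp (g := fun q : V × P => (fderiv ℝ f (‖q.1‖, q.2)).comp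
        (ContinuousLinearMap.inr ℝ ℝ P)) contDiff_const

theorem contDiff_comp_norm_of_even [FiniteDimensional ℝ P] {W : Type}
    [NormedAddCommGroup W] [NormedSpace ℝ W]
    [CompleteSpace W] {f : ℝ × P → W} (hf : ContDiff ℝ ∞ f)
    (he : ∀ r g, f (-r, g) = f (r, g)) :
    ContDiff ℝ ∞ (fun q : V × P => f (‖q.1‖, q.2)) :=
  contDiff_infty.2 fun k => contDiff_comp_norm_of_even_nat k hf he

end EvenNorm

/-- A smooth function of two real variables, even in each, is a smooth function of two vectors
upon inserting their norms. -/
theorem contDiff_comp_norm_norm_of_even {V₁ V₂ : Type} [NormedAddCommGroup V₁]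
    [InnerProductSpace ℝ V₁] [FiniteDimensional ℝ V₁] [NormedAddCommGroup V₂]
    [InnerProductSpace ℝ V₂] {f : ℝ × ℝ → ℝ} (hf : ContDiff ℝ ∞ f)
    (he₁ : ∀ r s, f (-r, s) = f (r, s)) (he₂ : ∀ r s, f (r, -s) = f (r, s)) :
    ContDiff ℝ ∞ (fun q : V₁ × V₂ => f (‖q.1‖, ‖q.2‖)) := by
  have h1 : ContDiff ℝ ∞ (fun q : V₁ × ℝ => f (‖q.1‖, q.2)) :=
    contDiff_comp_norm_of_even hf he₁
  have h2 : ContDiff ℝ ∞ (fun q : V₂ × V₁ => f (‖q.2‖, ‖q.1‖)) :=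
    contDiff_comp_norm_of_even (f := fun q : ℝ × V₁ => f (‖q.2‖, q.1))
      (h1.comp (contDiff_snd.prodMk contDiff_fst)) (fun r g => he₂ _ _)
  exact h2.comp (contDiff_snd.prodMk contDiff_fst)

/-! ### The Legendre transform of a smooth convex function with isolated degenerate points -/

section Legendre

variable {E : Type*} [NormedAddCommGroup E] [InnerProductSpace ℝ E]

theorem hasDerivAt_inner_comp_line {g : E → E} (hg : Differentiable ℝ g) (y v w : E) (t : ℝ) :
    HasDerivAt (fun t : ℝ => ⟪g (y + t • v), w⟫) ⟪fderiv ℝ g (y + t • v) v, w⟫ t := by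
  have h1 : HasDerivAt (fun t : ℝ => y + t • v) v t := by
    simpa using ((hasDerivAt_id t).smul_const v).const_add y
  have h2 := (hg (y + t • v)).hasFDerivAt.comp_hasDerivAt t h1
  simpa using h2.inner ℝ (hasDerivAt_const t w)

theorem monotone_inner_comp_line {g : E → E} (hg : Differentiable ℝ g)
    (hpsd : ∀ y v, 0 ≤ ⟪fderiv ℝ g y v, v⟫) (y v : E) :
    Monotone fun t : ℝ => ⟪g (y + t • v), v⟫ :=
  monotone_of_deriv_nonneg (fun t => (hasDerivAt_inner_comp_line hg y v v t).differentiableAt)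
    fun t => by rw [(hasDerivAt_inner_comp_line hg y v v t).deriv]; exact hpsd _ _

/-- A differentiable map whose derivative is positive semidefinite, and definite off a finite
set, is injective: along a segment on which the map does not increase, every point would have to
be degenerate. -/
theorem injective_of_fderiv_pos {g : E → E} (hg : Differentiable ℝ g)
    (hpsd : ∀ y v, 0 ≤ ⟪fderiv ℝ g y v, v⟫) {Z : Set E} (hZ : Z.Finite)
    (hpos : ∀ y ∉ Z, ∀ v ≠ 0, 0 < ⟪fderiv ℝ g y v, v⟫) : Function.Injective g := by
  intro y y' hyy'
  by_contra hne
  set v := y' - y with hv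
  have hv0 : v ≠ 0 := sub_ne_zero.2 (Ne.symm hne)
  have hmono := monotone_inner_comp_line hg hpsd y v
  have hconst : ∀ t ∈ Ioo (0 : ℝ) 1, ⟪g (y + t • v), v⟫ = ⟪g y, v⟫ := by
    intro t ht
    have h0 := hmono ht.1.le
    have h1 := hmono ht.2.le
    simp only [zero_smul, add_zero, one_smul] at h0 h1
    rw [hv, add_sub_cancel, ← hv, ← hyy'] at h1
    exact le_antisymm h1 h0
  have hmem : ∀ t ∈ Ioo (0 : ℝ) 1, y + t • v ∈ Z := by
    intro t ht
    by_contra hz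
    have h1 := hasDerivAt_inner_comp_line hg y v v t
    have h2 : (fun t : ℝ => ⟪g (y + t • v), v⟫) =ᶠ[nhds t] fun _ => ⟪g y, v⟫ :=
      Filter.eventually_of_mem (Ioo_mem_nhds ht.1 ht.2) hconst
    have h3 := h1.unique ((hasDerivAt_const t ⟪g y, v⟫).congr_of_eventuallyEq h2)
    exact (hpos _ hz v hv0).ne' h3
  have hinf : (Ioo (0 : ℝ) 1).Infinite := Ioo_infinite one_pos
  refine hinf (Set.Finite.of_finite_image (f := fun t : ℝ => y + t • v)
    (hZ.subset (by rintro _ ⟨t, ht, rfl⟩; exact hmem t ht)) ?_)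
  intro s _ t _ hst
  exact smul_left_injective ℝ hv0 (add_left_cancel hst)

theorem le_of_monotone_gradient [CompleteSpace E] {H : E → ℝ} {g : E → E}
    (hH : ∀ y, HasGradientAt H (g y) y)
    (hg : Differentiable ℝ g) (hpsd : ∀ y v, 0 ≤ ⟪fderiv ℝ g y v, v⟫) (y y' : E) :
    H y + ⟪g y, y' - y⟫ ≤ H y' := by
  set v := y' - y with hv
  have hder : ∀ t : ℝ, HasDerivAt (fun t : ℝ => H (y + t • v) - t * ⟪g y, v⟫)
      (⟪g (y + t • v), v⟫ - ⟪g y, v⟫) t := by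
    intro t
    have h1 : HasDerivAt (fun t : ℝ => y + t • v) v t := by
      simpa using ((hasDerivAt_id t).smul_const v).const_add y
    have h2 := (hH (y + t • v)).hasFDerivAt.comp_hasDerivAt t h1
    exact (h2.sub ((hasDerivAt_id t).mul_const ⟪g y, v⟫)).congr_deriv (by simp)
  have hmono := monotone_inner_comp_line hg hpsd y v
  have h := monotoneOn_of_deriv_nonneg (D := Icc (0 : ℝ) 1) (convex_Icc 0 1)
    (fun t _ => (hder t).continuousAt.continuousWithinAt)
    (fun t _ => (hder t).differentiableAt.differentiableWithinAt)
    (fun t ht => by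
      rw [interior_Icc] at ht
      rw [(hder t).deriv]
      have := hmono ht.1.le
      simp only [zero_smul, add_zero] at this
      linarith)
    (left_mem_Icc.2 zero_le_one) (right_mem_Icc.2 zero_le_one) zero_le_one
  simp only [zero_smul, add_zero, one_smul, zero_mul, sub_zero, one_mul] at h
  rw [hv, add_sub_cancel, ← hv] at h
  linarith

/-- By the chain rule, a derivative of the inverse would be a left inverse of the derivative. -/
theorem not_differentiableAt_symm_of_fderiv_eq_zero {g : E → E} {e : E ≃ₜ E}
    (he : ∀ y, e y = g y) (hg : Differentiable ℝ g) {y v : E} (hv : v ≠ 0)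
    (h0 : fderiv ℝ g y v = 0) : ¬ DifferentiableAt ℝ e.symm (g y) := by
  intro hd
  have h1 := hd.hasFDerivAt.comp y (hg y).hasFDerivAt
  have h2 : (e.symm ∘ g) = id := funext fun y => by
    simp [← he]
  rw [h2] at h1
  have h3 := DFunLike.congr_fun (h1.unique (hasFDerivAt_id y)) v
  simp [h0] at h3
  exact hv h3.symm

variable [FiniteDimensional ℝ E]

open Filter Topology in
/-- The Legendre transform `G` of a smooth convex superlinear function `H` whose Hessian is
definite off a finite set: the gradient map of `H` is a homeomorphism, and its inverse is the
gradient of `G`. -/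
theorem exists_legendre {H : E → ℝ} {g : E → E} (hH : ∀ y, HasGradientAt H (g y) y)
    (hg : Differentiable ℝ g) (hpsd : ∀ y v, 0 ≤ ⟪fderiv ℝ g y v, v⟫) {Z : Set E}
    (hZ : Z.Finite) (hpos : ∀ y ∉ Z, ∀ v ≠ 0, 0 < ⟪fderiv ℝ g y v, v⟫)
    (hco : ∀ K : ℝ, Tendsto (fun y => H y - K * ‖y‖) (cocompact E) atTop) :
    ∃ (e : E ≃ₜ E) (G : E → ℝ), (∀ y, e y = g y) ∧ (∀ p, HasGradientAt G (e.symm p) p) ∧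
      (∀ p y, ⟪p, y⟫ - H y ≤ G p) ∧ ∀ y, G (g y) = ⟪g y, y⟫ - H y := by
  have hHc : Continuous H := continuous_iff_continuousAt.2 fun y => (hH y).continuousAt
  have hinj := injective_of_fderiv_pos hg hpsd hZ hpos
  have hsurj : Function.Surjective g := by
    intro p
    have hlim : Tendsto (fun y => H y - ⟪p, y⟫) (cocompact E) atTop := by
      refine tendsto_atTop_mono (fun y => ?_) (hco ‖p‖)
      have := real_inner_le_norm p y
      linarith
    obtain ⟨y, hy⟩ := Continuous.exists_forall_le
      (hHc.sub (continuous_const.inner continuous_id)) hlim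
    refine ⟨y, ?_⟩
    have h1 : HasFDerivAt (fun y => H y - ⟪p, y⟫)
        (InnerProductSpace.toDual ℝ E (g y) - innerSL ℝ p) y :=
      (hH y).hasFDerivAt.sub (innerSL ℝ p).hasFDerivAt
    have h2 : IsLocalMin (fun y => H y - ⟪p, y⟫) y := Filter.Eventually.of_forall hy
    have h3 := h2.hasFDerivAt_eq_zero h1
    refine ext_inner_right ℝ fun v => ?_
    have h4 := DFunLike.congr_fun h3 v
    simpa [sub_eq_zero] using h4
  have hproper : Tendsto g (cocompact E) (cocompact E) := by
    nth_rewrite 2 [← Metric.cobounded_eq_cocompact]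
    rw [← tendsto_norm_atTop_iff_cobounded, Filter.tendsto_atTop]
    intro K
    filter_upwards [(hco K).eventually (eventually_ge_atTop (H 0 + 1))] with y hy
    have h1 := le_of_monotone_gradient hH hg hpsd y 0
    have h2 := real_inner_le_norm (g y) y
    simp only [zero_sub, inner_neg_right] at h1
    have hy0 : 0 < ‖y‖ := by
      rw [norm_pos_iff]
      rintro rfl
      simp at hy
      linarith
    by_contra hlt
    push Not at hlt
    have : ‖g y‖ * ‖y‖ < K * ‖y‖ := mul_lt_mul_of_pos_right hlt hy0
    linarith
  have hclosed : IsClosedMap g :=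
    (isProperMap_iff_tendsto_cocompact.2 ⟨hg.continuous, hproper⟩).isClosedMap
  let e : E ≃ₜ E := (Equiv.ofBijective g ⟨hinj, hsurj⟩).toHomeomorphOfContinuousClosed
    hg.continuous hclosed
  have he : ∀ y, e y = g y := fun y => rfl
  have hge : ∀ p, g (e.symm p) = p := fun p => e.apply_symm_apply p
  have hG : ∀ p y, ⟪p, y⟫ - H y ≤ ⟪p, e.symm p⟫ - H (e.symm p) := by
    intro p y
    have := le_of_monotone_gradient hH hg hpsd (e.symm p) y
    rw [hge, inner_sub_right] at this
    linarith
  refine ⟨e, fun p => ⟪p, e.symm p⟫ - H (e.symm p), he, fun p₀ => ?_, hG, fun y => ?_⟩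
  · rw [hasGradientAt_iff_isLittleO]
    have hc : Tendsto (fun p => e.symm p - e.symm p₀) (𝓝 p₀) (𝓝 0) := by
      refine Continuous.tendsto' (e.symm.continuous.sub continuous_const) _ _ ?_
      simp
    rw [Asymptotics.isLittleO_iff]
    intro c hcpos
    filter_upwards [hc.eventually (Metric.ball_mem_nhds 0 hcpos)] with p hp
    have hp' : ‖e.symm p - e.symm p₀‖ ≤ c := by
      have := mem_ball_zero_iff.1 hp
      exact this.le
    have h1 := hG p (e.symm p₀)
    have h2 := hG p₀ (e.symm p)
    have h3 : ⟪p - p₀, e.symm p - e.symm p₀⟫ ≤ c * ‖p - p₀‖ := by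
      refine (real_inner_le_norm _ _).trans ?_
      rw [mul_comm]
      gcongr
    simp only [inner_sub_left, inner_sub_right] at h3 ⊢
    rw [Real.norm_eq_abs, abs_le]
    have h4 := real_inner_comm p (e.symm p₀)
    have h5 := real_inner_comm p₀ (e.symm p₀)
    have h6 := real_inner_comm p (e.symm p)
    have h7 := real_inner_comm p₀ (e.symm p)
    have h8 : 0 ≤ c * ‖p - p₀‖ := by positivity
    constructor <;> linarith
  · have : e.symm (g y) = y := e.symm_apply_apply y
    simp only [this]

/-- If the gradient map `g` of `H` is smooth and non-degenerate off a finite set, then the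
Legendre transform is smooth off the image of that set. -/
theorem contDiffOn_legendre {G : E → ℝ} {g : E → E} {e : E ≃ₜ E} (he : ∀ y, e y = g y)
    (hG : ∀ p, HasGradientAt G (e.symm p) p) (hg : ContDiff ℝ ∞ g) {Z : Set E} (hZ : Z.Finite)
    (hpos : ∀ y ∉ Z, ∀ v ≠ 0, 0 < ⟪fderiv ℝ g y v, v⟫) : ContDiffOn ℝ ∞ G (g '' Z)ᶜ := by
  have hopen : IsOpen (g '' Z)ᶜ := (hZ.image g).isClosed.isOpen_compl
  have hge : ∀ p, g (e.symm p) = p := fun p => by rw [← he]; exact e.apply_symm_apply p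
  rw [contDiffOn_infty_iff_fderiv_of_isOpen hopen]
  refine ⟨fun p _ => (hG p).differentiableAt.differentiableWithinAt, fun p hp => ?_⟩
  have hy : e.symm p ∉ Z := fun h => hp ⟨e.symm p, h, hge p⟩
  have hfd : fderiv ℝ G = fun p => InnerProductSpace.toDual ℝ E (e.symm p) :=
    funext fun p => (hG p).hasFDerivAt.fderiv
  rw [hfd]
  have hinj : Function.Injective (fderiv ℝ g (e.symm p)) := by
    rw [injective_iff_map_eq_zero]
    intro v hv
    by_contra hv0
    have := hpos _ hy v hv0
    rw [hv, inner_zero_left] at this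
    exact lt_irrefl _ this
  let L : E ≃L[ℝ] E := (LinearEquiv.ofInjectiveEndo (fderiv ℝ g (e.symm p) : E →ₗ[ℝ] E)
    hinj).toContinuousLinearEquiv
  have hL : HasFDerivAt e.toOpenPartialHomeomorph (L : E →L[ℝ] E)
      (e.toOpenPartialHomeomorph.symm p) := by
    have h1 : (L : E →L[ℝ] E) = fderiv ℝ g (e.symm p) := by
      ext v; rfl
    have h2 : (e.toOpenPartialHomeomorph : E → E) = g := funext he
    rw [h1, h2]
    exact (hg.differentiable (by simp) _).hasFDerivAt
  have hs : ContDiffAt ℝ ∞ e.symm p := by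
    refine e.toOpenPartialHomeomorph.contDiffAt_symm (mem_univ p) hL ?_
    have h2 : (e.toOpenPartialHomeomorph : E → E) = g := funext he
    rw [h2]
    exact hg.contDiffAt
  exact ((InnerProductSpace.toDual ℝ E).contDiff.contDiffAt.comp p hs).contDiffWithinAt

end Legendre

/-! ### The profile of the gradient along the image of the cone -/

/-- The odd polynomial `s ↦ v(s) - s³ / 10`, where `v` is the profile of the divergence-free
field, with `a = n - 1/2`. -/
noncomputable def profilePoly (a s : ℝ) : ℝ :=
  s * (a * (5 - 4 * s ^ 2 + 4 * s ^ 4) + 9 - 29 * s ^ 2 + 40 * s ^ 4 - 20 * s ^ 6) - s ^ 3 / 10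

/-- The derivative of `profilePoly a`, as a function of `X = s ^ 2`. -/
noncomputable def profileSlope (a X : ℝ) : ℝ :=
  a * (5 - 12 * X + 20 * X ^ 2) + 9 - 87 * X + 200 * X ^ 2 - 140 * X ^ 3 - 3 * X / 10

/-- `profileSlope a` on `X ≤ 1`, smoothly replaced by the constant `1` on `X ≥ 1 + 1/100`. -/
noncomputable def slopeFun (a X : ℝ) : ℝ :=
  (1 - Real.smoothTransition (100 * (X - 1))) * profileSlope a X +
    Real.smoothTransition (100 * (X - 1))

theorem hasDerivAt_profilePoly (a s : ℝ) :
    HasDerivAt (profilePoly a) (profileSlope a (s ^ 2)) s := by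
  have h2 : HasDerivAt (fun s : ℝ => s ^ 2) (2 * s) s := by simpa using hasDerivAt_pow 2 s
  have h3 : HasDerivAt (fun s : ℝ => s ^ 3) (3 * s ^ 2) s := by simpa using hasDerivAt_pow 3 s
  have h4 : HasDerivAt (fun s : ℝ => s ^ 4) (4 * s ^ 3) s := by simpa using hasDerivAt_pow 4 s
  have h6 : HasDerivAt (fun s : ℝ => s ^ 6) (6 * s ^ 5) s := by simpa using hasDerivAt_pow 6 s
  have h := ((hasDerivAt_id s).mul ((((((((h2.const_mul 4).const_sub 5).add
    (h4.const_mul 4)).const_mul a).add_const 9).sub (h2.const_mul 29)).add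
    (h4.const_mul 40)).sub (h6.const_mul 20))).sub (h3.div_const 10)
  refine h.congr_deriv ?_
  simp only [profileSlope, id, Pi.add_apply, Pi.sub_apply]
  ring

/-- The slope is positive slightly beyond `X = 1`, which leaves room for the transition in
`slopeFun`. The coefficient of `a` is positive, so `a = 3 / 2` is the worst case. -/
theorem profileSlope_ge {a X : ℝ} (ha : 3 / 2 ≤ a) (h0 : 0 ≤ X) (h1 : X ≤ 1 + 1 / 100) :
    1 / 4 ≤ profileSlope a X := by
  have h2 : 3 / 2 * (5 - 12 * X + 20 * X ^ 2) ≤ a * (5 - 12 * X + 20 * X ^ 2) :=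
    mul_le_mul_of_nonneg_right ha (by nlinarith [sq_nonneg (10 * X - 3)])
  have h3 : 0 ≤ 16.25 - 105.3 * X + 230 * X ^ 2 - 140 * X ^ 3 := by
    nlinarith [mul_nonneg h0 (sq_nonneg (X - 0.8)),
      mul_nonneg (sub_nonneg.2 h1) (sq_nonneg (X - 0.32)),
      sq_nonneg (X - 0.32), mul_nonneg h0 (sub_nonneg.2 h1)]
  unfold profileSlope
  linarith

theorem slopeFun_ge {a X : ℝ} (ha : 3 / 2 ≤ a) (h0 : 0 ≤ X) : 1 / 4 ≤ slopeFun a X := by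
  unfold slopeFun
  have hθ0 := Real.smoothTransition.nonneg (100 * (X - 1))
  have hθ1 := Real.smoothTransition.le_one (100 * (X - 1))
  rcases le_total X (1 + 1 / 100) with h | h
  · nlinarith [profileSlope_ge ha h0 h]
  · rw [Real.smoothTransition.one_of_one_le (by linarith)]
    norm_num

theorem slopeFun_of_le_one {a X : ℝ} (h : X ≤ 1) : slopeFun a X = profileSlope a X := by
  unfold slopeFun
  rw [Real.smoothTransition.zero_of_nonpos (by linarith)]
  ring

theorem slopeFun_of_ge {a X : ℝ} (h : 1 + 1 / 100 ≤ X) : slopeFun a X = 1 := by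
  unfold slopeFun
  rw [Real.smoothTransition.one_of_one_le (by linarith)]
  ring

theorem contDiff_slopeFun (a : ℝ) : ContDiff ℝ ∞ (slopeFun a) := by
  unfold slopeFun profileSlope
  have h : ContDiff ℝ ∞ fun X : ℝ => Real.smoothTransition (100 * (X - 1)) :=
    Real.smoothTransition.contDiff.comp (by fun_prop)
  exact ((contDiff_const.sub h).mul (by fun_prop)).add h

theorem exists_slopeFun_le (a : ℝ) : ∃ C, ∀ X, 0 ≤ X → slopeFun a X ≤ C := by
  obtain ⟨C, hC⟩ := ((isCompact_Icc (a := (0 : ℝ)) (b := 2)).image_of_continuousOn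
    (contDiff_slopeFun a).continuous.continuousOn).bddAbove
  refine ⟨max C 1, fun X hX => ?_⟩
  rcases le_total X 2 with h | h
  · exact (hC ⟨X, ⟨hX, h⟩, rfl⟩).trans (le_max_left _ _)
  · rw [slopeFun_of_ge (by linarith)]
    exact le_max_right _ _

theorem exists_abs_deriv_slopeFun_le (a : ℝ) : ∃ C, ∀ X, 0 ≤ X → |deriv (slopeFun a) X| ≤ C := by
  obtain ⟨C, hC⟩ := ((isCompact_Icc (a := (0 : ℝ)) (b := 2)).image_of_continuousOn
    ((contDiff_slopeFun a).continuous_deriv (by simp)).abs.continuousOn).bddAbove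
  refine ⟨max C 0, fun X hX => ?_⟩
  rcases le_total X 2 with h | h
  · exact (hC ⟨X, ⟨hX, h⟩, rfl⟩).trans (le_max_left _ _)
  · have : slopeFun a =ᶠ[nhds X] fun _ => 1 := by
      filter_upwards [lt_mem_nhds (show (1 + 1 / 100 : ℝ) < X by linarith)] with Y hY
      exact slopeFun_of_ge hY.le
    rw [this.deriv_eq]
    simp

/-- An odd diffeomorphism of `ℝ` that agrees with `profilePoly a` on `[-1, 1]` and has slope `1`
away from a neighbourhood of that interval. -/
noncomputable def profile (a s : ℝ) : ℝ := ∫ t in (0 : ℝ)..s, slopeFun a (t ^ 2)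

theorem hasDerivAt_profile (a s : ℝ) : HasDerivAt (profile a) (slopeFun a (s ^ 2)) s := by
  have hc : Continuous fun t : ℝ => slopeFun a (t ^ 2) :=
    (contDiff_slopeFun a).continuous.comp (by fun_prop)
  exact intervalIntegral.integral_hasDerivAt_right (hc.intervalIntegrable _ _)
    (hc.stronglyMeasurableAtFilter _ _) hc.continuousAt

theorem contDiff_profile (a : ℝ) : ContDiff ℝ ∞ (profile a) := by
  rw [contDiff_infty_iff_deriv]
  refine ⟨fun s => (hasDerivAt_profile a s).differentiableAt, ?_⟩
  rw [show deriv (profile a) = fun s => slopeFun a (s ^ 2) from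
    funext fun s => (hasDerivAt_profile a s).deriv]
  exact (contDiff_slopeFun a).comp (by fun_prop)

theorem profile_neg (a s : ℝ) : profile a (-s) = -profile a s := by
  unfold profile
  have h := intervalIntegral.integral_comp_neg (a := 0) (b := s) fun t : ℝ => slopeFun a (t ^ 2)
  simp only [neg_sq, neg_zero] at h
  rw [intervalIntegral.integral_symm, ← h]

theorem profile_eq {a s : ℝ} (hs : |s| ≤ 1) : profile a s = profilePoly a s := by
  unfold profile
  have h0 : profilePoly a 0 = 0 := by simp [profilePoly]
  rw [show profilePoly a s = profilePoly a s - profilePoly a 0 by rw [h0, sub_zero]]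
  have hc : Continuous fun t : ℝ => profileSlope a (t ^ 2) := by
    unfold profileSlope
    fun_prop
  rw [← intervalIntegral.integral_eq_sub_of_hasDerivAt
    (fun t _ => hasDerivAt_profilePoly a t) (hc.intervalIntegrable _ _)]
  refine intervalIntegral.integral_congr fun t ht => slopeFun_of_le_one ?_
  rw [sq_le_one_iff_abs_le_one]
  have h1 := abs_sub_left_of_mem_uIcc ht
  simp only [sub_zero] at h1
  exact h1.trans hs

/-- The inverse of `profile a`, with the bounds on its first two derivatives. -/
theorem exists_inverse_profile {a : ℝ} (ha : 3 / 2 ≤ a) :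
    ∃ j : ℝ → ℝ, ContDiff ℝ ∞ j ∧ (∀ y, j (-y) = -j y) ∧
      (∃ c > 0, ∃ C, ∀ y, c ≤ deriv j y ∧ deriv j y ≤ C) ∧
      (∃ C, ∀ y, |j y * deriv (deriv j) y| ≤ C * j y ^ 2) ∧
      ∀ s, |s| ≤ 1 → j (profilePoly a s) = s := by
  have hpos : ∀ s : ℝ, 1 / 4 ≤ slopeFun a (s ^ 2) := fun s => slopeFun_ge ha (sq_nonneg s)
  have hmono : StrictMono (profile a) := strictMono_of_deriv_pos fun s => by
    rw [(hasDerivAt_profile a s).deriv]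
    linarith [hpos s]
  have hcont : Continuous (profile a) := (contDiff_profile a).continuous
  have h0 : profile a 0 = 0 := by simp [profile]
  have hgrow : ∀ s, 0 ≤ s → s / 4 ≤ profile a s := by
    intro s hs
    have h := (convex_Ici (0 : ℝ)).mul_sub_le_image_sub_of_le_deriv (f := profile a) (C := 1 / 4)
      hcont.continuousOn (contDiff_profile a |>.differentiable (by simp)).differentiableOn
      (fun x _ => by rw [(hasDerivAt_profile a x).deriv]; exact hpos x) 0 self_mem_Ici s hs hs
    rw [h0] at h
    linarith
  have htop : Filter.Tendsto (profile a) Filter.atTop Filter.atTop := by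
    refine Filter.tendsto_atTop_mono' _ ?_
      (Filter.tendsto_id.atTop_div_const (show (0 : ℝ) < 4 by norm_num))
    filter_upwards [Filter.eventually_ge_atTop 0] with s hs using hgrow s hs
  have hbot : Filter.Tendsto (profile a) Filter.atBot Filter.atBot := by
    have h := Filter.tendsto_neg_atTop_atBot.comp (htop.comp Filter.tendsto_neg_atBot_atTop)
    refine h.congr fun s => ?_
    simp [profile_neg]
  let e : ℝ ≃ₜ ℝ := (hmono.orderIsoOfSurjective _ (hcont.surjective htop hbot)).toHomeomorph
  have he : ∀ s, e s = profile a s := fun s => rfl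
  have hinv : ∀ y, profile a (e.symm y) = y := fun y => e.apply_symm_apply y
  have hinv' : ∀ s, e.symm (profile a s) = s := fun s => e.symm_apply_apply s
  have hder : ∀ y, HasDerivAt e.symm (slopeFun a (e.symm y ^ 2))⁻¹ y := fun y =>
    HasDerivAt.of_local_left_inverse e.symm.continuous.continuousAt
      (hasDerivAt_profile a (e.symm y)) (by linarith [hpos (e.symm y)])
      (Filter.Eventually.of_forall hinv)
  have hsm : ContDiff ℝ ∞ e.symm :=
    e.contDiff_symm_deriv (f' := fun s => slopeFun a (s ^ 2))
      (fun s => by linarith [hpos s]) (hasDerivAt_profile a) (contDiff_profile a)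
  have hderiv : deriv e.symm = fun y => (slopeFun a (e.symm y ^ 2))⁻¹ :=
    funext fun y => (hder y).deriv
  obtain ⟨C₁, hC₁⟩ := exists_slopeFun_le a
  obtain ⟨C₂, hC₂⟩ := exists_abs_deriv_slopeFun_le a
  have hC₁pos : 0 < C₁ := by linarith [hC₁ 0 le_rfl, slopeFun_ge ha (le_refl (0 : ℝ))]
  have hC₂nn : 0 ≤ C₂ := (abs_nonneg _).trans (hC₂ 0 le_rfl)
  refine ⟨e.symm, hsm, fun y => ?_, ⟨C₁⁻¹, by positivity, 4, fun y => ?_⟩,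
    ⟨2 * C₂ * 4 ^ 3, fun y => ?_⟩, fun s hs => ?_⟩
  · apply hmono.injective
    rw [hinv, profile_neg, hinv]
  · rw [hderiv]
    have h1 := hpos (e.symm y)
    have h2 := hC₁ (e.symm y ^ 2) (sq_nonneg _)
    refine ⟨inv_anti₀ (by linarith) h2, ?_⟩
    calc (slopeFun a (e.symm y ^ 2))⁻¹ ≤ (1 / 4)⁻¹ := inv_anti₀ (by norm_num) h1
      _ = 4 := by norm_num
  · have h1 := hpos (e.symm y)
    have h2 := hC₂ (e.symm y ^ 2) (sq_nonneg _)
    set s := e.symm y with hs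
    set q := slopeFun a (s ^ 2) with hq
    have hdd : HasDerivAt (deriv e.symm)
        (-(deriv (slopeFun a) (s ^ 2) * (2 * s * q⁻¹)) / q ^ 2) y := by
      rw [hderiv]
      have h3 : HasDerivAt (fun y => e.symm y ^ 2) (2 * s * q⁻¹) y := by
        exact ((hder y).pow 2).congr_deriv (by simp [hq, hs])
      have h4 : HasDerivAt (slopeFun a) (deriv (slopeFun a) (s ^ 2)) (s ^ 2) :=
        ((contDiff_slopeFun a).differentiable (by simp) _).hasDerivAt
      exact (HasDerivAt.comp y h4 h3).inv (by
        change slopeFun a (s ^ 2) ≠ 0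
        linarith)
    rw [hdd.deriv]
    have hqpos : 0 < q := by linarith
    have h5 : s * (-(deriv (slopeFun a) (s ^ 2) * (2 * s * q⁻¹)) / q ^ 2) =
        -(2 * deriv (slopeFun a) (s ^ 2) * (q⁻¹) ^ 3 * s ^ 2) := by
      field_simp
    have hqi : q⁻¹ ≤ 4 := by
      calc q⁻¹ ≤ (1 / 4)⁻¹ := inv_anti₀ (by norm_num) h1
        _ = 4 := by norm_num
    rw [h5, abs_neg, abs_mul, abs_mul, abs_mul, abs_of_nonneg (sq_nonneg s),
      abs_of_pos (show (0 : ℝ) < 2 by norm_num),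
      abs_of_nonneg (show 0 ≤ q⁻¹ ^ 3 by positivity)]
    gcongr
  · rw [← profile_eq hs, hinv']

/-! ### The dual potential in the plane -/

/-- The Euclidean plane. -/
abbrev Plane : Type := WithLp 2 (ℝ × ℝ)

/-- The vector of the plane with the given coordinates. -/
def planePt (u v : ℝ) : Plane := WithLp.toLp 2 (u, v)

@[simp] theorem planePt_fst (u v : ℝ) : (planePt u v).fst = u := rfl

@[simp] theorem planePt_snd (u v : ℝ) : (planePt u v).snd = v := rfl

theorem plane_inner (x y : Plane) : ⟪x, y⟫ = x.fst * y.fst + x.snd * y.snd := by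
  simp [WithLp.prod_inner_apply, mul_comm]

theorem plane_norm_sq (x : Plane) : ‖x‖ ^ 2 = x.fst ^ 2 + x.snd ^ 2 := by
  rw [← real_inner_self_eq_norm_sq, plane_inner]
  ring

theorem plane_ext {x y : Plane} (h₁ : x.fst = y.fst) (h₂ : x.snd = y.snd) : x = y :=
  WithLp.ofLp_injective 2 (Prod.ext h₁ h₂)

/-- A convex-type function of `σ = s² + t²` whose derivative `(σ - 1)² / (1 + σ²)` vanishes to
second order exactly on the unit circle. -/
noncomputable def radialFun (σ : ℝ) : ℝ := σ - Real.log (1 + σ ^ 2)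

/-- The derivative of `radialFun`. -/
noncomputable def radialFun₁ (σ : ℝ) : ℝ := 1 - 2 * σ / (1 + σ ^ 2)

/-- The second derivative of `radialFun`. -/
noncomputable def radialFun₂ (σ : ℝ) : ℝ := 2 * (σ ^ 2 - 1) / (1 + σ ^ 2) ^ 2

theorem hasDerivAt_radialFun (σ : ℝ) : HasDerivAt radialFun (radialFun₁ σ) σ := by
  have h1 : HasDerivAt (fun σ : ℝ => 1 + σ ^ 2) (2 * σ) σ := by
    simpa using (hasDerivAt_pow 2 σ).const_add 1
  exact (hasDerivAt_id σ).sub (h1.log (by positivity))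

theorem hasDerivAt_radialFun₁ (σ : ℝ) : HasDerivAt radialFun₁ (radialFun₂ σ) σ := by
  have h1 : HasDerivAt (fun σ : ℝ => 1 + σ ^ 2) (2 * σ) σ := by
    simpa using (hasDerivAt_pow 2 σ).const_add 1
  have h2 : HasDerivAt (fun σ : ℝ => 2 * σ) 2 σ := by simpa using (hasDerivAt_id σ).const_mul 2
  have h := (h2.div h1 (by positivity)).const_sub 1
  refine h.congr_deriv ?_
  unfold radialFun₂
  field_simp
  ring

theorem contDiff_radialFun₁ : ContDiff ℝ ∞ radialFun₁ := by
  unfold radialFun₁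
  exact contDiff_const.sub ((contDiff_const.mul contDiff_id).div
    (contDiff_const.add (contDiff_id.pow 2)) fun σ => by positivity)

theorem radialFun₁_eq (σ : ℝ) : radialFun₁ σ = (σ - 1) ^ 2 / (1 + σ ^ 2) := by
  unfold radialFun₁
  field_simp
  ring

theorem radialFun₁_nonneg (σ : ℝ) : 0 ≤ radialFun₁ σ := by
  rw [radialFun₁_eq]
  positivity

theorem radialFun₁_pos {σ : ℝ} (h : σ ≠ 1) : 0 < radialFun₁ σ := by
  rw [radialFun₁_eq]
  have : σ - 1 ≠ 0 := sub_ne_zero.2 h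
  positivity

theorem radialFun₁_le_one {σ : ℝ} (h : 0 ≤ σ) : radialFun₁ σ ≤ 1 := by
  unfold radialFun₁
  have : 0 ≤ 2 * σ / (1 + σ ^ 2) := by positivity
  linarith

theorem neg_two_le_radialFun₂ (σ : ℝ) : -2 ≤ radialFun₂ σ := by
  unfold radialFun₂
  rw [le_div_iff₀ (by positivity)]
  nlinarith [sq_nonneg σ, sq_nonneg (σ ^ 2)]

theorem radialFun_nonneg {σ : ℝ} (h : 0 ≤ σ) : 0 ≤ radialFun σ := by
  have h1 := Real.quadratic_le_exp_of_nonneg (show 0 ≤ σ / 2 by positivity)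
  have h2 : 1 + σ ^ 2 ≤ Real.exp σ := by
    have h3 : Real.exp σ = Real.exp (σ / 2) ^ 2 := by
      rw [← Real.exp_nat_mul]
      congr 1
      push_cast
      ring
    rw [h3]
    have h4 : (1 + σ / 2 + (σ / 2) ^ 2 / 2) ^ 2 ≤ Real.exp (σ / 2) ^ 2 := by gcongr
    refine le_trans ?_ h4
    nlinarith [mul_nonneg h (sq_nonneg (σ - 2)), sq_nonneg (σ ^ 2), mul_nonneg h h]
  have h5 := Real.log_le_log (by positivity) h2
  rw [Real.log_exp] at h5
  unfold radialFun
  linarith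

/-- The potential `H(y) = h(y₁) + h(y₂) + ε k(j(y₁)² + j(y₂)²)` with `h' = j³` and
`k = radialFun`. -/
noncomputable def dualPotential (j : ℝ → ℝ) (ε : ℝ) (y : Plane) : ℝ :=
  (∫ t in (0 : ℝ)..y.fst, j t ^ 3) + (∫ t in (0 : ℝ)..y.snd, j t ^ 3) +
    ε * radialFun (j y.fst ^ 2 + j y.snd ^ 2)

/-- The gradient of `dualPotential j ε`. -/
noncomputable def dualGradient (j : ℝ → ℝ) (ε : ℝ) (y : Plane) : Plane :=
  planePt
    (j y.fst ^ 3 + 2 * ε * radialFun₁ (j y.fst ^ 2 + j y.snd ^ 2) * (j y.fst * deriv j y.fst))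
    (j y.snd ^ 3 + 2 * ε * radialFun₁ (j y.fst ^ 2 + j y.snd ^ 2) * (j y.snd * deriv j y.snd))

section DualPotential

variable {j : ℝ → ℝ}

theorem hasFDerivAt_comp_fst {f : ℝ → ℝ} {f' : ℝ} {y : Plane} (h : HasDerivAt f f' y.fst) :
    HasFDerivAt (fun y : Plane => f y.fst) (f' • WithLp.fstL 2 ℝ ℝ ℝ) y :=
  HasDerivAt.comp_hasFDerivAt (f := fun y : Plane => y.fst) y h (WithLp.fstL 2 ℝ ℝ ℝ).hasFDerivAt

theorem hasFDerivAt_comp_snd {f : ℝ → ℝ} {f' : ℝ} {y : Plane} (h : HasDerivAt f f' y.snd) :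
    HasFDerivAt (fun y : Plane => f y.snd) (f' • WithLp.sndL 2 ℝ ℝ ℝ) y :=
  HasDerivAt.comp_hasFDerivAt (f := fun y : Plane => y.snd) y h (WithLp.sndL 2 ℝ ℝ ℝ).hasFDerivAt

theorem hasDerivAt_sq_of_contDiff (hj : ContDiff ℝ ∞ j) (t : ℝ) :
    HasDerivAt (fun t => j t ^ 2) (2 * (j t * deriv j t)) t := by
  have h := ((hj.differentiable (by simp)) t).hasDerivAt.pow 2
  exact h.congr_deriv (by simp; ring)

theorem hasFDerivAt_sq_add_sq (hj : ContDiff ℝ ∞ j) (y : Plane) :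
    HasFDerivAt (fun y : Plane => j y.fst ^ 2 + j y.snd ^ 2)
      ((2 * (j y.fst * deriv j y.fst)) • WithLp.fstL 2 ℝ ℝ ℝ +
        (2 * (j y.snd * deriv j y.snd)) • WithLp.sndL 2 ℝ ℝ ℝ) y :=
  (hasFDerivAt_comp_fst (hasDerivAt_sq_of_contDiff hj y.fst)).add
    (hasFDerivAt_comp_snd (hasDerivAt_sq_of_contDiff hj y.snd))

theorem hasGradientAt_dualPotential (hj : ContDiff ℝ ∞ j) (ε : ℝ) (y : Plane) :
    HasGradientAt (dualPotential j ε) (dualGradient j ε y) y := by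
  have hc : Continuous fun t => j t ^ 3 := hj.continuous.pow 3
  have hint : ∀ s, HasDerivAt (fun s => ∫ t in (0 : ℝ)..s, j t ^ 3) (j s ^ 3) s := fun s =>
    intervalIntegral.integral_hasDerivAt_right (hc.intervalIntegrable _ _)
      (hc.stronglyMeasurableAtFilter _ _) hc.continuousAt
  have h := ((hasFDerivAt_comp_fst (hint y.fst)).add (hasFDerivAt_comp_snd (hint y.snd))).add
    (((hasDerivAt_radialFun _).comp_hasFDerivAt y (hasFDerivAt_sq_add_sq hj y)).const_mul ε)
  rw [hasGradientAt_iff_hasFDerivAt]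
  refine h.congr_fderiv ?_
  ext v
  simp only [InnerProductSpace.toDual_apply_apply, plane_inner, dualGradient, add_apply, smul_apply,
    WithLp.fstL_apply, WithLp.sndL_apply, smul_eq_mul, planePt_fst, planePt_snd]
  ring

/-- The Hessian of `dualPotential j ε`. -/
theorem hasFDerivAt_dualGradient (hj : ContDiff ℝ ∞ j) (ε : ℝ) (y : Plane) :
    ∃ L : Plane →L[ℝ] Plane, HasFDerivAt (dualGradient j ε) L y ∧ ∀ v : Plane, L v =
      planePt
        ((3 * j y.fst ^ 2 * deriv j y.fst + 2 * ε * radialFun₁ (j y.fst ^ 2 + j y.snd ^ 2) *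
            (deriv j y.fst ^ 2 + j y.fst * deriv (deriv j) y.fst)) * v.fst +
          4 * ε * radialFun₂ (j y.fst ^ 2 + j y.snd ^ 2) * (j y.fst * deriv j y.fst) *
            (j y.fst * deriv j y.fst * v.fst + j y.snd * deriv j y.snd * v.snd))
        ((3 * j y.snd ^ 2 * deriv j y.snd + 2 * ε * radialFun₁ (j y.fst ^ 2 + j y.snd ^ 2) *
            (deriv j y.snd ^ 2 + j y.snd * deriv (deriv j) y.snd)) * v.snd +
          4 * ε * radialFun₂ (j y.fst ^ 2 + j y.snd ^ 2) * (j y.snd * deriv j y.snd) *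
            (j y.fst * deriv j y.fst * v.fst + j y.snd * deriv j y.snd * v.snd)) := by
  have hj1 : ∀ t, HasDerivAt j (deriv j t) t := fun t =>
    ((hj.differentiable (by simp)) t).hasDerivAt
  have hj2 : ∀ t, HasDerivAt (deriv j) (deriv (deriv j) t) t := fun t =>
    (((contDiff_infty_iff_deriv.1 hj).2.differentiable (by simp)) t).hasDerivAt
  have hcube : ∀ t, HasDerivAt (fun t => j t ^ 3) (3 * j t ^ 2 * deriv j t) t := fun t =>
    ((hj1 t).pow 3).congr_deriv (by simp)
  have hτ : ∀ t, HasDerivAt (fun t => j t * deriv j t)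
      (deriv j t ^ 2 + j t * deriv (deriv j) t) t := fun t =>
    ((hj1 t).mul (hj2 t)).congr_deriv (by ring)
  have hk := (((hasDerivAt_radialFun₁ _).comp_hasFDerivAt y
    (hasFDerivAt_sq_add_sq hj y)).const_mul (2 * ε))
  have h1 := (hasFDerivAt_comp_fst (hcube y.fst)).add
    (hk.mul (hasFDerivAt_comp_fst (hτ y.fst)))
  have h2 := (hasFDerivAt_comp_snd (hcube y.snd)).add
    (hk.mul (hasFDerivAt_comp_snd (hτ y.snd)))
  refine ⟨_, ((WithLp.prodContinuousLinearEquiv 2 ℝ ℝ ℝ).symm.hasFDerivAt).comp y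
    (h1.prodMk h2), fun v => ?_⟩
  apply plane_ext
  · simp
    ring
  · simp
    ring

theorem contDiff_dualGradient (hj : ContDiff ℝ ∞ j) (ε : ℝ) : ContDiff ℝ ∞ (dualGradient j ε) := by
  have h1 : ContDiff ℝ ∞ fun y : Plane => j y.fst := hj.comp (WithLp.fstL 2 ℝ ℝ ℝ).contDiff
  have h2 : ContDiff ℝ ∞ fun y : Plane => j y.snd := hj.comp (WithLp.sndL 2 ℝ ℝ ℝ).contDiff
  have hd : ContDiff ℝ ∞ (deriv j) := (contDiff_infty_iff_deriv.1 hj).2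
  have h3 : ContDiff ℝ ∞ fun y : Plane => deriv j y.fst := hd.comp (WithLp.fstL 2 ℝ ℝ ℝ).contDiff
  have h4 : ContDiff ℝ ∞ fun y : Plane => deriv j y.snd := hd.comp (WithLp.sndL 2 ℝ ℝ ℝ).contDiff
  have h5 : ContDiff ℝ ∞ fun y : Plane => radialFun₁ (j y.fst ^ 2 + j y.snd ^ 2) :=
    contDiff_radialFun₁.comp ((h1.pow 2).add (h2.pow 2))
  exact (WithLp.prodContinuousLinearEquiv 2 ℝ ℝ ℝ).symm.contDiff.comp
    (((h1.pow 3).add ((contDiff_const.mul h5).mul (h1.mul h3))).prodMk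
      ((h2.pow 3).add ((contDiff_const.mul h5).mul (h2.mul h4))))

/-- Lower bound for the Hessian of the dual potential. For small `ε` the indefinite contributions
of the radial term are absorbed by the separable part. -/
theorem inner_fderiv_dualGradient_ge (hj : ContDiff ℝ ∞ j) {c C D ε : ℝ} (hc : 0 < c)
    (hjc : ∀ t, c ≤ deriv j t ∧ deriv j t ≤ C)
    (hD : ∀ t, |j t * deriv (deriv j) t| ≤ D * j t ^ 2) (hε : 0 ≤ ε)
    (hεc : ε * (D + 8 * C ^ 2) ≤ c) (y v : Plane) :
    (c * j y.fst ^ 2 + 2 * ε * c ^ 2 * radialFun₁ (j y.fst ^ 2 + j y.snd ^ 2)) * v.fst ^ 2 +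
      (c * j y.snd ^ 2 + 2 * ε * c ^ 2 * radialFun₁ (j y.fst ^ 2 + j y.snd ^ 2)) * v.snd ^ 2 ≤
      ⟪fderiv ℝ (dualGradient j ε) y v, v⟫ := by
  obtain ⟨L, hL, hLv⟩ := hasFDerivAt_dualGradient hj ε y
  rw [hL.fderiv, hLv, plane_inner]
  simp only [planePt_fst, planePt_snd]
  set σ := j y.fst ^ 2 + j y.snd ^ 2 with hσ
  have hk0 := radialFun₁_nonneg σ
  have hk1 : radialFun₁ σ ≤ 1 := radialFun₁_le_one (by positivity)
  have hk2 := neg_two_le_radialFun₂ σ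
  set k₁ := radialFun₁ σ
  set k₂ := radialFun₂ σ
  have main : ∀ t, c * j t ^ 2 + 2 * ε * c ^ 2 * k₁ ≤
      3 * j t ^ 2 * deriv j t + 2 * ε * k₁ * (deriv j t ^ 2 + j t * deriv (deriv j) t) -
        16 * ε * (j t * deriv j t) ^ 2 := by
    intro t
    obtain ⟨h1, h2⟩ := hjc t
    have h3 := (abs_le.1 (hD t)).1
    have hDj : 0 ≤ D * j t ^ 2 := (abs_nonneg _).trans (hD t)
    have h4 : c ^ 2 ≤ deriv j t ^ 2 := by gcongr
    have h5 : deriv j t ^ 2 ≤ C ^ 2 := by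
      have : 0 ≤ deriv j t := hc.le.trans h1
      gcongr
    have h6 : 2 * ε * k₁ * (c ^ 2 - D * j t ^ 2) ≤
        2 * ε * k₁ * (deriv j t ^ 2 + j t * deriv (deriv j) t) := by
      apply mul_le_mul_of_nonneg_left _ (by positivity)
      linarith
    have h7 : 2 * ε * k₁ * (D * j t ^ 2) ≤ 2 * ε * (D * j t ^ 2) := by
      have : 0 ≤ 2 * ε * (D * j t ^ 2) := by positivity
      nlinarith
    have h8 : 16 * ε * (j t * deriv j t) ^ 2 ≤ 16 * ε * (j t ^ 2 * C ^ 2) := by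
      rw [mul_pow]
      gcongr
    have h9 : 3 * j t ^ 2 * c ≤ 3 * j t ^ 2 * deriv j t := by gcongr
    have h10 : j t ^ 2 * (ε * (D + 8 * C ^ 2)) ≤ j t ^ 2 * c := by gcongr
    linarith
  have m1 := mul_le_mul_of_nonneg_right (main y.fst) (sq_nonneg v.fst)
  have m2 := mul_le_mul_of_nonneg_right (main y.snd) (sq_nonneg v.snd)
  set τ₁ := j y.fst * deriv j y.fst
  set τ₂ := j y.snd * deriv j y.snd
  have h11 : -(8 * ε) * (τ₁ * v.fst + τ₂ * v.snd) ^ 2 ≤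
      4 * ε * k₂ * (τ₁ * v.fst + τ₂ * v.snd) ^ 2 := by
    apply mul_le_mul_of_nonneg_right _ (sq_nonneg _)
    nlinarith
  have h12 : 8 * ε * (τ₁ * v.fst + τ₂ * v.snd) ^ 2 ≤
      16 * ε * (τ₁ ^ 2 * v.fst ^ 2 + τ₂ ^ 2 * v.snd ^ 2) := by
    nlinarith [mul_nonneg hε (sq_nonneg (τ₁ * v.fst - τ₂ * v.snd))]
  linarith

theorem integral_pow_three_ge (hj : ContDiff ℝ ∞ j) (hodd : ∀ t, j (-t) = -j t) {c : ℝ}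
    (hc : 0 < c) (hjc : ∀ t, c ≤ deriv j t) (s : ℝ) :
    c ^ 3 / 4 * s ^ 4 ≤ ∫ t in (0 : ℝ)..s, j t ^ 3 := by
  have h0 : j 0 = 0 := by
    have := hodd 0
    rw [neg_zero] at this
    linarith
  have hlin : ∀ t, 0 ≤ t → c * t ≤ j t := by
    intro t ht
    have h := (convex_Ici (0 : ℝ)).mul_sub_le_image_sub_of_le_deriv (f := j) (C := c)
      hj.continuous.continuousOn (hj.differentiable (by simp)).differentiableOn
      (fun x _ => hjc x) 0 self_mem_Ici t ht ht
    rw [h0] at h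
    linarith
  have hcont : Continuous fun t => j t ^ 3 := hj.continuous.pow 3
  have hpos : ∀ s, 0 ≤ s → c ^ 3 / 4 * s ^ 4 ≤ ∫ t in (0 : ℝ)..s, j t ^ 3 := by
    intro s hs
    have h1 : ∫ t in (0 : ℝ)..s, c ^ 3 * t ^ 3 = c ^ 3 / 4 * s ^ 4 := by
      rw [intervalIntegral.integral_const_mul, integral_pow]
      norm_num
      ring
    rw [← h1]
    apply intervalIntegral.integral_mono_on hs
      ((by fun_prop : Continuous fun t : ℝ => c ^ 3 * t ^ 3).intervalIntegrable _ _)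
      (hcont.intervalIntegrable _ _)
    intro t ht
    rw [← mul_pow]
    have := hlin t ht.1
    have h2 : 0 ≤ c * t := mul_nonneg hc.le ht.1
    gcongr
  rcases le_total 0 s with h | h
  · exact hpos s h
  · have h1 := hpos (-s) (by linarith)
    have h2 := intervalIntegral.integral_comp_neg (a := 0) (b := s) fun t : ℝ => j t ^ 3
    simp only [hodd, neg_zero] at h2
    rw [intervalIntegral.integral_symm, ← h2, ← intervalIntegral.integral_neg] at h1
    convert h1 using 1
    · ring
    · congr 1
      ext t
      ring

theorem dualPotential_swap (ε : ℝ) (u v : ℝ) :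
    dualPotential j ε (planePt v u) = dualPotential j ε (planePt u v) := by
  simp only [dualPotential, planePt_fst, planePt_snd]
  rw [add_comm (∫ t in (0 : ℝ)..v, j t ^ 3), add_comm (j v ^ 2)]

theorem dualPotential_neg (hodd : ∀ t, j (-t) = -j t) (ε : ℝ) (y : Plane) :
    dualPotential j ε (-y) = dualPotential j ε y := by
  have h : ∀ s, ∫ t in (0 : ℝ)..(-s), j t ^ 3 = ∫ t in (0 : ℝ)..s, j t ^ 3 := by
    intro s
    have h2 := intervalIntegral.integral_comp_neg (a := 0) (b := s) fun t : ℝ => j t ^ 3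
    simp only [hodd, neg_zero] at h2
    rw [intervalIntegral.integral_symm, ← h2, ← intervalIntegral.integral_neg]
    congr 1
    ext t
    ring
  simp only [dualPotential, WithLp.neg_fst, WithLp.neg_snd, h, hodd, neg_sq]

open Filter Topology in
theorem tendsto_dualPotential_sub (hj : ContDiff ℝ ∞ j) (hodd : ∀ t, j (-t) = -j t) {c ε : ℝ}
    (hc : 0 < c) (hjc : ∀ t, c ≤ deriv j t) (hε : 0 ≤ ε) (K : ℝ) :
    Tendsto (fun y => dualPotential j ε y - K * ‖y‖) (cocompact Plane) atTop := by
  have hlow : ∀ y : Plane, c ^ 3 / 8 * ‖y‖ ^ 4 ≤ dualPotential j ε y := by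
    intro y
    have h1 := integral_pow_three_ge hj hodd hc hjc y.fst
    have h2 := integral_pow_three_ge hj hodd hc hjc y.snd
    have h3 := mul_nonneg hε (radialFun_nonneg
      (show 0 ≤ j y.fst ^ 2 + j y.snd ^ 2 by positivity))
    have h4 : ‖y‖ ^ 4 = (y.fst ^ 2 + y.snd ^ 2) ^ 2 := by
      rw [← plane_norm_sq]
      ring
    have h5 : (y.fst ^ 2 + y.snd ^ 2) ^ 2 ≤ 2 * (y.fst ^ 4 + y.snd ^ 4) := by
      nlinarith [sq_nonneg (y.fst ^ 2 - y.snd ^ 2)]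
    have h6 := mul_le_mul_of_nonneg_left h5 (show 0 ≤ c ^ 3 / 8 by positivity)
    unfold dualPotential
    rw [h4]
    linarith
  have hnorm : Tendsto (fun y : Plane => ‖y‖) (cocompact Plane) atTop :=
    tendsto_norm_cocompact_atTop
  refine tendsto_atTop_mono' _ ?_ hnorm
  filter_upwards [hnorm.eventually (eventually_ge_atTop 1),
    hnorm.eventually (eventually_ge_atTop ((|K| + 1) * (8 / c ^ 3)))] with y hy1 hy2
  have h1 := hlow y
  have h2 : |K| + 1 ≤ c ^ 3 / 8 * ‖y‖ := by
    have := mul_le_mul_of_nonneg_left hy2 (show 0 ≤ c ^ 3 / 8 by positivity)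
    field_simp at this ⊢
    linarith
  have h3 : ‖y‖ ^ 2 ≤ ‖y‖ ^ 4 := by
    apply pow_le_pow_right₀ hy1
    norm_num
  have h4 : c ^ 3 / 8 * ‖y‖ ^ 2 ≤ c ^ 3 / 8 * ‖y‖ ^ 4 := by gcongr
  have h5 : (|K| + 1) * ‖y‖ ≤ c ^ 3 / 8 * ‖y‖ * ‖y‖ := by gcongr
  have h6 : K * ‖y‖ ≤ |K| * ‖y‖ := by gcongr; exact le_abs_self K
  nlinarith

end DualPotential

/-! ### The planar integrand -/

/-- The four points `(0, ±1)`, `(±1, 0)` at which the planar integrand fails to be twice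
differentiable: the cusps of the astroid `s ↦ (s³, t³)`, `s² + t² = 1`. -/
def cuspSet : Set Plane := {p | p.fst * p.snd = 0 ∧ p.fst ^ 2 + p.snd ^ 2 = 1}

theorem planePt_self (p : Plane) : planePt p.fst p.snd = p := rfl

/-- A Legendre transform inherits the symmetries of the potential. -/
theorem legendre_symm {E : Type*} [NormedAddCommGroup E] [InnerProductSpace ℝ E] {H G : E → ℝ}
    {g : E → E} (hsurj : Function.Surjective g) (hle : ∀ p y, ⟪p, y⟫ - H y ≤ G p)
    (heq : ∀ y, G (g y) = ⟪g y, y⟫ - H y) {T : E → E} (hTT : ∀ p, T (T p) = p)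
    (hT : ∀ p y, ⟪T p, T y⟫ = ⟪p, y⟫) (hHT : ∀ y, H (T y) = H y) (p : E) : G (T p) = G p := by
  have key : ∀ p, G p ≤ G (T p) := by
    intro p
    obtain ⟨y, rfl⟩ := hsurj p
    have := hle (T (g y)) (T y)
    rw [hT, hHT] at this
    rw [heq]
    exact this
  refine le_antisymm ?_ (key p)
  have := key (T p)
  rwa [hTT] at this

theorem convexOn_legendre {E : Type*} [NormedAddCommGroup E] [InnerProductSpace ℝ E] {H G : E → ℝ}
    {g : E → E} (hsurj : Function.Surjective g) (hle : ∀ p y, ⟪p, y⟫ - H y ≤ G p)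
    (heq : ∀ y, G (g y) = ⟪g y, y⟫ - H y) : ConvexOn ℝ univ G := by
  refine ⟨convex_univ, fun p _ q _ a b ha hb hab => ?_⟩
  obtain ⟨y, hy⟩ := hsurj (a • p + b • q)
  have h1 := mul_le_mul_of_nonneg_left (hle p y) ha
  have h2 := mul_le_mul_of_nonneg_left (hle q y) hb
  have h3 : (a + b) * H y = H y := by rw [hab, one_mul]
  rw [← hy, heq, hy, inner_add_left, real_inner_smul_left, real_inner_smul_left]
  simp only [smul_eq_mul]
  linarith

/-- A convex planar function `G`, smooth off the four cusps, whose gradient takes the values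
`(profilePoly a s, profilePoly a t)` along the astroid. It is the Legendre transform of the dual
potential; its gradient is not differentiable at the cusps. -/
theorem exists_planar_integrand {a : ℝ} (ha : 3 / 2 ≤ a) :
    ∃ (G : Plane → ℝ) (G' : Plane → Plane), (∀ p, HasGradientAt G (G' p) p) ∧ Continuous G' ∧
      ConvexOn ℝ univ G ∧ ContDiffOn ℝ ∞ G cuspSetᶜ ∧
      (∀ p ∈ cuspSet, ¬ DifferentiableAt ℝ G' p) ∧
      (∀ u v, G (planePt v u) = G (planePt u v)) ∧ (∀ p, G (-p) = G p) ∧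
      ∀ s t : ℝ, s ^ 2 + t ^ 2 = 1 →
        G' (planePt (s ^ 3) (t ^ 3)) = planePt (profilePoly a s) (profilePoly a t) := by
  obtain ⟨j, hj, hodd, ⟨c, hc, C, hjc⟩, ⟨D, hD⟩, hinv⟩ := exists_inverse_profile ha
  set D' := |D| with hD'
  have hDD : ∀ t, |j t * deriv (deriv j) t| ≤ D' * j t ^ 2 := fun t =>
    (hD t).trans (mul_le_mul_of_nonneg_right (le_abs_self D) (sq_nonneg _))
  -- The size of the perturbation for which `inner_fderiv_dualGradient_ge` applies.
  set ε := c / (D' + 8 * C ^ 2 + 1) with hε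
  have hden : 0 < D' + 8 * C ^ 2 + 1 := by positivity
  have hεpos : 0 < ε := by positivity
  have hεc : ε * (D' + 8 * C ^ 2) ≤ c := by
    rw [hε, div_mul_eq_mul_div, div_le_iff₀ hden]
    nlinarith
  have hjinj : Function.Injective j :=
    (strictMono_of_deriv_pos fun t => hc.trans_le (hjc t).1).injective
  set g := dualGradient j ε with hg
  set Z : Set Plane := {y | j y.fst * j y.snd = 0 ∧ j y.fst ^ 2 + j y.snd ^ 2 = 1} with hZ
  have hgs : ContDiff ℝ ∞ g := contDiff_dualGradient hj ε
  have hlow := inner_fderiv_dualGradient_ge hj hc hjc hDD hεpos.le hεc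
  have hpsd : ∀ y v, 0 ≤ ⟪fderiv ℝ g y v, v⟫ := by
    intro y v
    refine le_trans ?_ (hlow y v)
    have := radialFun₁_nonneg (j y.fst ^ 2 + j y.snd ^ 2)
    positivity
  have hpos : ∀ y ∉ Z, ∀ v ≠ 0, 0 < ⟪fderiv ℝ g y v, v⟫ := by
    intro y hy v hv
    refine lt_of_lt_of_le ?_ (hlow y v)
    have hk := radialFun₁_nonneg (j y.fst ^ 2 + j y.snd ^ 2)
    have hcoef : 0 < c * j y.fst ^ 2 + 2 * ε * c ^ 2 * radialFun₁ (j y.fst ^ 2 + j y.snd ^ 2) ∧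
        0 < c * j y.snd ^ 2 + 2 * ε * c ^ 2 * radialFun₁ (j y.fst ^ 2 + j y.snd ^ 2) := by
      by_cases h1 : j y.fst ^ 2 + j y.snd ^ 2 = 1
      · have h2 : j y.fst * j y.snd ≠ 0 := fun h => hy ⟨h, h1⟩
        have h3 := left_ne_zero_of_mul h2
        have h4 := right_ne_zero_of_mul h2
        constructor <;> positivity
      · have := radialFun₁_pos h1
        constructor <;> positivity
    by_cases hv1 : v.fst = 0
    · have hv2 : v.snd ≠ 0 := fun h => hv (plane_ext hv1 h)
      have := mul_pos hcoef.2 (show 0 < v.snd ^ 2 by positivity)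
      have := mul_nonneg hcoef.1.le (sq_nonneg v.fst)
      linarith
    · have := mul_pos hcoef.1 (show 0 < v.fst ^ 2 by positivity)
      have := mul_nonneg hcoef.2.le (sq_nonneg v.snd)
      linarith
  have hZg : ∀ y : Plane, j y.fst ^ 2 + j y.snd ^ 2 = 1 →
      g y = planePt (j y.fst ^ 3) (j y.snd ^ 3) := by
    intro y hy
    have h1 : radialFun₁ 1 = 0 := by simp [radialFun₁_eq]
    apply plane_ext <;> simp [hg, dualGradient, hy, h1]
  have hjabs : ∀ s t : ℝ, s ^ 2 + t ^ 2 = 1 →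
      j (profilePoly a s) = s ∧ j (profilePoly a t) = t := by
    intro s t hst
    refine ⟨hinv s ?_, hinv t ?_⟩ <;> rw [← sq_le_one_iff_abs_le_one] <;>
      nlinarith [sq_nonneg s, sq_nonneg t]
  have hcircle : ∀ s t : ℝ, s ^ 2 + t ^ 2 = 1 →
      g (planePt (profilePoly a s) (profilePoly a t)) = planePt (s ^ 3) (t ^ 3) := by
    intro s t hst
    obtain ⟨h1, h2⟩ := hjabs s t hst
    rw [hZg]
    · simp [h1, h2]
    · simp [h1, h2, hst]
  -- A coordinate of a point of `Z` or of `cuspSet` takes one of the values `0`, `1`, `-1`.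
  have hvals : ∀ s t : ℝ, s * t = 0 → s ^ 2 + t ^ 2 = 1 →
      (s = 0 ∨ s = 1 ∨ s = -1) ∧ (t = 0 ∨ t = 1 ∨ t = -1) := by
    intro s t h0 h1
    rcases mul_eq_zero.1 h0 with rfl | rfl
    · exact ⟨Or.inl rfl, Or.inr (sq_eq_one_iff.1 (by linarith))⟩
    · exact ⟨Or.inr (sq_eq_one_iff.1 (by linarith)), Or.inl rfl⟩
  have hZfin : Z.Finite := by
    have h3 : ({0, 1, -1} : Set ℝ).Finite := by simp
    refine ((h3.prod h3).image fun q : ℝ × ℝ =>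
      planePt (profilePoly a q.1) (profilePoly a q.2)).subset ?_
    rintro y ⟨h0, h1⟩
    obtain ⟨h4, h5⟩ := hjabs _ _ h1
    obtain ⟨h6, h7⟩ := hvals _ _ h0 h1
    exact ⟨(j y.fst, j y.snd), ⟨by simpa using h6, by simpa using h7⟩,
      plane_ext (hjinj h4) (hjinj h5)⟩
  have hcusp : g '' Z = cuspSet := by
    ext p
    constructor
    · rintro ⟨y, ⟨h0, h1⟩, rfl⟩
      rw [hZg y h1]
      obtain ⟨h6, h7⟩ := hvals _ _ h0 h1
      refine ⟨?_, ?_⟩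
      · simp only [planePt_fst, planePt_snd]
        rw [← mul_pow, h0]
        norm_num
      · simp only [planePt_fst, planePt_snd]
        rcases mul_eq_zero.1 h0 with h | h <;> rw [h] at h1 ⊢
        · have : j y.snd ^ 2 = 1 := by linarith
          calc ((0 : ℝ) ^ 3) ^ 2 + (j y.snd ^ 3) ^ 2 = (j y.snd ^ 2) ^ 3 := by ring
            _ = 1 := by rw [this]; norm_num
        · have : j y.fst ^ 2 = 1 := by linarith
          calc (j y.fst ^ 3) ^ 2 + ((0 : ℝ) ^ 3) ^ 2 = (j y.fst ^ 2) ^ 3 := by ring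
            _ = 1 := by rw [this]; norm_num
    · rintro ⟨h0, h1⟩
      obtain ⟨h4, h5⟩ := hjabs _ _ h1
      obtain ⟨h6, h7⟩ := hvals _ _ h0 h1
      refine ⟨planePt (profilePoly a p.fst) (profilePoly a p.snd), ⟨?_, ?_⟩, ?_⟩
      · simp [h4, h5, h0]
      · simp [h4, h5, h1]
      · have hcube : ∀ s : ℝ, (s = 0 ∨ s = 1 ∨ s = -1) → s ^ 3 = s := by
          rintro s (rfl | rfl | rfl) <;> norm_num
        rw [hcircle _ _ h1, hcube _ h6, hcube _ h7, planePt_self]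
  obtain ⟨e, G, he, hG, hle, heq⟩ := exists_legendre (hasGradientAt_dualPotential hj ε)
    (hgs.differentiable (by simp)) hpsd hZfin hpos
    (tendsto_dualPotential_sub hj hodd hc (fun t => (hjc t).1) hεpos.le)
  change ∀ y, e y = g y at he
  have hsurj : Function.Surjective g := fun p =>
    ⟨e.symm p, by rw [← he]; exact e.apply_symm_apply p⟩
  refine ⟨G, e.symm, hG, e.symm.continuous, convexOn_legendre hsurj hle heq, ?_, ?_, ?_, ?_, ?_⟩
  · rw [← hcusp]
    exact contDiffOn_legendre he hG hgs hZfin hpos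
  · rw [← hcusp]
    rintro _ ⟨y, ⟨h0, h1⟩, rfl⟩
    obtain ⟨L, hL, hLv⟩ := hasFDerivAt_dualGradient hj ε y
    have hk1 : radialFun₁ 1 = 0 := by simp [radialFun₁_eq]
    have hk2 : radialFun₂ 1 = 0 := by simp [radialFun₂]
    rcases mul_eq_zero.1 h0 with h | h
    · refine not_differentiableAt_symm_of_fderiv_eq_zero he (hgs.differentiable (by simp))
        (v := planePt 1 0) (fun h' => ?_) ?_
      · have := congrArg (fun p : Plane => p.fst) h'
        simp at this
      · rw [hL.fderiv, hLv, h1, hk1, hk2, h]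
        apply plane_ext <;> simp
    · refine not_differentiableAt_symm_of_fderiv_eq_zero he (hgs.differentiable (by simp))
        (v := planePt 0 1) (fun h' => ?_) ?_
      · have := congrArg (fun p : Plane => p.snd) h'
        simp at this
      · rw [hL.fderiv, hLv, h1, hk1, hk2, h]
        apply plane_ext <;> simp
  · intro u v
    exact legendre_symm hsurj hle heq (T := fun p : Plane => planePt p.snd p.fst)
      (fun p => rfl) (fun p y => by simp [add_comm])
      (fun y => dualPotential_swap ε y.fst y.snd) (planePt u v)
  · exact legendre_symm hsurj hle heq (T := fun p : Plane => -p) (fun p => neg_neg p)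
      (fun p y => inner_neg_neg p y) (dualPotential_neg hodd ε)
  · intro s t hst
    rw [← hcircle s t hst, ← he]
    exact e.symm_apply_apply _

/-! ### Functions of the two norms -/

section NormLift

variable {V : Type} [NormedAddCommGroup V] [InnerProductSpace ℝ V]

/-- The function `(p₁, p₂) ↦ f (|p₁|, |p₂|)` on `V × V`. -/
def normLift (f : ℝ × ℝ → ℝ) (p : WithLp 2 (V × V)) : ℝ := f (‖p.fst‖, ‖p.snd‖)

/-- An even convex function on the line is nondecreasing on the nonnegative half-line. -/
theorem ConvexOn.le_of_even {f : ℝ → ℝ} (hf : ConvexOn ℝ univ f) (he : ∀ r, f (-r) = f r)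
    {r r' : ℝ} (hr : 0 ≤ r) (h : r ≤ r') : f r ≤ f r' := by
  have hseg : r ∈ segment ℝ (-r') r' := by
    rw [segment_eq_Icc (by linarith)]
    exact ⟨by linarith, h⟩
  have := hf.le_on_segment (mem_univ _) (mem_univ _) hseg
  rwa [he, max_self] at this

theorem ConvexOn.normLift {f : ℝ × ℝ → ℝ} (hf : ConvexOn ℝ univ f)
    (he₁ : ∀ r s, f (-r, s) = f (r, s)) (he₂ : ∀ r s, f (r, -s) = f (r, s)) :
    ConvexOn ℝ univ (normLift f : WithLp 2 (V × V) → ℝ) := by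
  have hc₁ : ∀ s, ConvexOn ℝ univ fun r => f (r, s) := by
    intro s
    refine ⟨convex_univ, fun r _ r' _ a b ha hb hab => ?_⟩
    have := hf.2 (mem_univ (r, s)) (mem_univ (r', s)) ha hb hab
    rwa [Prod.smul_mk, Prod.smul_mk, Prod.mk_add_mk, ← add_smul, hab, one_smul] at this
  have hc₂ : ∀ r, ConvexOn ℝ univ fun s => f (r, s) := by
    intro r
    refine ⟨convex_univ, fun s _ s' _ a b ha hb hab => ?_⟩
    have := hf.2 (mem_univ (r, s)) (mem_univ (r, s')) ha hb hab
    rwa [Prod.smul_mk, Prod.smul_mk, Prod.mk_add_mk, ← add_smul, hab, one_smul] at this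
  refine ⟨convex_univ, fun p _ q _ a b ha hb hab => ?_⟩
  have hn : ∀ x y : V, ‖a • x + b • y‖ ≤ a * ‖x‖ + b * ‖y‖ := by
    intro x y
    refine (norm_add_le _ _).trans_eq ?_
    rw [norm_smul, norm_smul, Real.norm_of_nonneg ha, Real.norm_of_nonneg hb]
  have h := hf.2 (mem_univ (‖p.fst‖, ‖p.snd‖)) (mem_univ (‖q.fst‖, ‖q.snd‖)) ha hb hab
  refine le_trans ?_ h
  simp only [_root_.normLift, WithLp.add_fst, WithLp.smul_fst, WithLp.add_snd, WithLp.smul_snd]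
  exact ((hc₁ _).le_of_even (fun r => he₁ r _) (norm_nonneg _) (hn _ _)).trans
    ((hc₂ _).le_of_even (fun s => he₂ _ s) (norm_nonneg _) (hn _ _))

/-- If `f` is even in each variable and smooth off the four points `(±1, ±1)`, then
`f (|p₁|, |p₂|)` is smooth off `|p₁| = |p₂| = 1`. A cutoff near the four points reduces this to
globally smooth `f`; evenness takes care of the zeros of the norms. -/
theorem contDiffAt_normLift [FiniteDimensional ℝ V] {f : ℝ × ℝ → ℝ}
    (hf : ∀ q : ℝ × ℝ, ¬ (q.1 ^ 2 = 1 ∧ q.2 ^ 2 = 1) → ContDiffAt ℝ ∞ f q)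
    (he₁ : ∀ r s, f (-r, s) = f (r, s)) (he₂ : ∀ r s, f (r, -s) = f (r, s))
    {p : WithLp 2 (V × V)} (hp : ¬ (‖p.fst‖ = 1 ∧ ‖p.snd‖ = 1)) :
    ContDiffAt ℝ ∞ (normLift f) p := by
  set ρ : ℝ × ℝ → ℝ := fun q => (q.1 ^ 2 - 1) ^ 2 + (q.2 ^ 2 - 1) ^ 2 with hρ
  have hρs : ContDiff ℝ ∞ ρ := by fun_prop
  have hρ0 : ∀ q : ℝ × ℝ, 0 < ρ q → ¬ (q.1 ^ 2 = 1 ∧ q.2 ^ 2 = 1) := by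
    rintro q h ⟨h1, h2⟩
    simp [hρ, h1, h2] at h
  set δ := ρ (‖p.fst‖, ‖p.snd‖) with hδ
  have hδ0 : 0 < δ := by
    refine lt_of_le_of_ne (by positivity) fun h => hp ?_
    have h1 : (‖p.fst‖ ^ 2 - 1) ^ 2 + (‖p.snd‖ ^ 2 - 1) ^ 2 = 0 := h.symm
    have h2 : ‖p.fst‖ ^ 2 = 1 := by nlinarith [sq_nonneg (‖p.fst‖ ^ 2 - 1)]
    have h3 : ‖p.snd‖ ^ 2 = 1 := by nlinarith [sq_nonneg (‖p.snd‖ ^ 2 - 1)]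
    exact ⟨(pow_eq_one_iff_of_nonneg (norm_nonneg _) two_ne_zero).1 h2,
      (pow_eq_one_iff_of_nonneg (norm_nonneg _) two_ne_zero).1 h3⟩
  set χ : ℝ × ℝ → ℝ := fun q => Real.smoothTransition (4 * ρ q / δ - 1) with hχ
  have hχs : ContDiff ℝ ∞ χ := Real.smoothTransition.contDiff.comp (by fun_prop)
  have hfχ : ContDiff ℝ ∞ fun q => χ q * f q := by
    rw [contDiff_iff_contDiffAt]
    intro q
    by_cases hq : 0 < ρ q
    · exact hχs.contDiffAt.mul (hf q (hρ0 q hq))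
    · have hev : ∀ᶠ q' in nhds q, ρ q' < δ / 4 :=
        hρs.continuous.continuousAt.eventually_lt continuousAt_const (by linarith)
      refine (contDiffAt_const (c := (0 : ℝ))).congr_of_eventuallyEq ?_
      filter_upwards [hev] with q' hq'
      have : χ q' = 0 := by
        apply Real.smoothTransition.zero_of_nonpos
        rw [sub_nonpos, div_le_one hδ0]
        linarith
      rw [this, zero_mul]
  have hlift := contDiff_comp_norm_norm_of_even (V₁ := V) (V₂ := V) hfχ
    (fun r s => by simp only [hχ, hρ, neg_sq, he₁]) (fun r s => by simp only [hχ, hρ, neg_sq, he₂])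
  have hlift' := hlift.comp (WithLp.prodContinuousLinearEquiv 2 ℝ V V).contDiff
  refine hlift'.contDiffAt.congr_of_eventuallyEq ?_
  have hcont : Continuous fun q : WithLp 2 (V × V) => ρ (‖q.fst‖, ‖q.snd‖) :=
    hρs.continuous.comp ((WithLp.fstL 2 ℝ V V).continuous.norm.prodMk
      (WithLp.sndL 2 ℝ V V).continuous.norm)
  have hev : ∀ᶠ q : WithLp 2 (V × V) in nhds p, δ / 2 < ρ (‖q.fst‖, ‖q.snd‖) :=
    continuousAt_const.eventually_lt hcont.continuousAt (by rw [← hδ]; linarith)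
  filter_upwards [hev] with q hq
  have : χ (‖q.fst‖, ‖q.snd‖) = 1 := by
    apply Real.smoothTransition.one_of_one_le
    rw [le_sub_iff_add_le, le_div_iff₀ hδ0]
    linarith
  change f (‖q.fst‖, ‖q.snd‖) = χ (‖q.fst‖, ‖q.snd‖) * f (‖q.fst‖, ‖q.snd‖)
  rw [this, one_mul]

theorem hasFDerivAt_norm_of_ne_zero {x : V} (hx : x ≠ 0) :
    HasFDerivAt (fun x : V => ‖x‖) (‖x‖⁻¹ • innerSL ℝ x) x := by
  have h := (hasStrictFDerivAt_norm_sq x).hasFDerivAt.sqrt (by simpa using hx)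
  simp only [Real.sqrt_sq (norm_nonneg _)] at h
  refine h.congr_fderiv ?_
  ext v
  simp
  field_simp

theorem contDiffAt_normLift_of_ne_zero {f : ℝ × ℝ → ℝ} {k : ℕ∞} (hf : ContDiff ℝ k f)
    {p : WithLp 2 (V × V)} (h₁ : p.fst ≠ 0) (h₂ : p.snd ≠ 0) : ContDiffAt ℝ k (normLift f) p := by
  have h1 : ContDiffAt ℝ k (fun q : WithLp 2 (V × V) => ‖q.fst‖) p :=
    (contDiffAt_norm ℝ h₁).comp p (WithLp.fstL 2 ℝ V V).contDiff.contDiffAt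
  have h2 : ContDiffAt ℝ k (fun q : WithLp 2 (V × V) => ‖q.snd‖) p :=
    (contDiffAt_norm ℝ h₂).comp p (WithLp.sndL 2 ℝ V V).contDiff.contDiffAt
  exact hf.contDiffAt.comp p (h1.prodMk h2)

end NormLift

/-! ### Uniform convexity and the degeneracy set -/

section Pinched

variable {E : Type*} [NormedAddCommGroup E] [InnerProductSpace ℝ E] {F : E → ℝ} {m : ℝ}

/-- The second derivative of a strongly convex function is bounded below wherever it exists. -/
theorem StrongConvexOn.le_fderiv_fderiv (hF : StrongConvexOn univ m F) (hd : Differentiable ℝ F)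
    {p : E} (hp : DifferentiableAt ℝ (fderiv ℝ F) p) (ξ : E) :
    m * ‖ξ‖ ^ 2 ≤ fderiv ℝ (fderiv ℝ F) p ξ ξ := by
  have hline : ∀ t : ℝ, HasDerivAt (fun t : ℝ => p + t • ξ) ξ t := fun t => by
    simpa using ((hasDerivAt_id t).smul_const ξ).const_add p
  have hconv : ConvexOn ℝ univ fun t : ℝ => F (p + t • ξ) - m / 2 * ‖p + t • ξ‖ ^ 2 := by
    have h := (strongConvexOn_iff_convex.1 hF).comp_affineMap
      (AffineMap.lineMap p (p + ξ) : ℝ →ᵃ[ℝ] E)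
    have he : (fun t : ℝ => F (p + t • ξ) - m / 2 * ‖p + t • ξ‖ ^ 2) =
        (fun x => F x - m / 2 * ‖x‖ ^ 2) ∘ (AffineMap.lineMap p (p + ξ) : ℝ →ᵃ[ℝ] E) := by
      ext t
      simp [AffineMap.lineMap_apply, add_comm]
    rw [he]
    exact h
  have hder : ∀ t : ℝ, HasDerivAt (fun t : ℝ => F (p + t • ξ) - m / 2 * ‖p + t • ξ‖ ^ 2)
      (fderiv ℝ F (p + t • ξ) ξ - m * ⟪p + t • ξ, ξ⟫) t := by
    intro t
    have h1 := (hd (p + t • ξ)).hasFDerivAt.comp_hasDerivAt t (hline t)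
    have h2 := ((hline t).norm_sq).const_mul (m / 2)
    exact (h1.sub h2).congr_deriv (by ring)
  have hmono : Monotone fun t : ℝ => fderiv ℝ F (p + t • ξ) ξ - m * ⟪p + t • ξ, ξ⟫ := by
    have h := hconv.monotoneOn_deriv fun t _ => (hder t).differentiableAt
    rw [monotoneOn_univ] at h
    rwa [show deriv _ = _ from funext fun t => (hder t).deriv] at h
  have hder2 : HasDerivAt (fun t : ℝ => fderiv ℝ F (p + t • ξ) ξ - m * ⟪p + t • ξ, ξ⟫)
      (fderiv ℝ (fderiv ℝ F) p ξ ξ - m * ‖ξ‖ ^ 2) 0 := by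
    have h0 : p + (0 : ℝ) • ξ = p := by simp
    have h1 := (h0.symm ▸ hp.hasFDerivAt : HasFDerivAt (fderiv ℝ F) (fderiv ℝ (fderiv ℝ F) p)
      (p + (0 : ℝ) • ξ)).comp_hasDerivAt 0 (hline 0)
    have h2 := h1.clm_apply (hasDerivAt_const (0 : ℝ) ξ)
    have h3 := ((hline 0).inner ℝ (hasDerivAt_const (0 : ℝ) ξ)).const_mul m
    refine (h2.sub h3).congr_deriv ?_
    simp
  have := hmono.deriv_nonneg (x := 0)
  rw [hder2.deriv] at this
  linarith

theorem notMem_degeneracySet_iff {p : E} :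
    p ∉ degeneracySet F ↔ ∃ k > 1, p ∈ hessianPinched F k := by
  simp [degeneracySet]

/-- Off its degeneracy set a strongly convex `C¹` function is exactly twice differentiable. -/
theorem notMem_degeneracySet_iff_differentiableAt (hm : 0 < m) (hF : StrongConvexOn univ m F)
    (hd : Differentiable ℝ F) {p : E} :
    p ∉ degeneracySet F ↔ DifferentiableAt ℝ (fderiv ℝ F) p := by
  rw [notMem_degeneracySet_iff]
  refine ⟨fun ⟨k, _, hk⟩ => hk.1, fun hp => ?_⟩
  set L := fderiv ℝ (fderiv ℝ F) p with hL
  refine ⟨m⁻¹ + ‖L‖ + 2, by have := inv_pos.2 hm; have := norm_nonneg L; linarith, hp, ?_⟩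
  intro ξ hξ
  have hξ' : 0 < ‖ξ‖ ^ 2 := by positivity
  have hmi := inv_pos.2 hm
  have hL0 := norm_nonneg L
  constructor
  · refine lt_of_lt_of_le ?_ (hF.le_fderiv_fderiv hd hp ξ)
    refine mul_lt_mul_of_pos_right ?_ hξ'
    exact inv_lt_of_inv_lt₀ hm (by linarith)
  · calc L ξ ξ ≤ ‖L ξ ξ‖ := le_abs_self _
      _ ≤ ‖L‖ * ‖ξ‖ * ‖ξ‖ := L.le_opNorm₂ ξ ξ
      _ = ‖L‖ * ‖ξ‖ ^ 2 := by ring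
      _ < _ := mul_lt_mul_of_pos_right (by linarith) hξ'

end Pinched

/-! ### The integrand -/

section Integrand

variable {V : Type} [NormedAddCommGroup V] [InnerProductSpace ℝ V]

/-- The planar function `G` in the coordinates `(r, s)` with `u = (s - r) / 2`,
`v = (s + r) / 2`. -/
noncomputable def rotated (G : Plane → ℝ) (q : ℝ × ℝ) : ℝ :=
  G (planePt ((q.2 - q.1) / 2) ((q.2 + q.1) / 2))

/-- The linear change of coordinates in `rotated`. -/
noncomputable def planeTurn : ℝ × ℝ →L[ℝ] Plane :=
  (WithLp.prodContinuousLinearEquiv 2 ℝ ℝ ℝ).symm.toContinuousLinearMap.comp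
    (((1 / 2 : ℝ) • (ContinuousLinearMap.snd ℝ ℝ ℝ - ContinuousLinearMap.fst ℝ ℝ ℝ)).prod
      ((1 / 2 : ℝ) • (ContinuousLinearMap.snd ℝ ℝ ℝ + ContinuousLinearMap.fst ℝ ℝ ℝ)))

theorem planeTurn_apply (q : ℝ × ℝ) :
    planeTurn q = planePt ((q.2 - q.1) / 2) ((q.2 + q.1) / 2) := by
  apply plane_ext <;> simp [planeTurn] <;> ring

theorem rotated_eq_comp (G : Plane → ℝ) : rotated G = G ∘ planeTurn := by
  ext q
  rw [Function.comp_apply, planeTurn_apply, rotated]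

/-- The linear embedding of the plane in `V × V` that carries `(u, v)` to
`((v - u) x₁, (v + u) x₂)`. -/
noncomputable def planeEmbedding (p : WithLp 2 (V × V)) : Plane →L[ℝ] WithLp 2 (V × V) :=
  (WithLp.prodContinuousLinearEquiv 2 ℝ V V).symm.toContinuousLinearMap.comp
    (((WithLp.sndL 2 ℝ ℝ ℝ - WithLp.fstL 2 ℝ ℝ ℝ).smulRight p.fst).prod
      ((WithLp.sndL 2 ℝ ℝ ℝ + WithLp.fstL 2 ℝ ℝ ℝ).smulRight p.snd))

theorem planeEmbedding_fst (p : WithLp 2 (V × V)) (q : Plane) :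
    (planeEmbedding p q).fst = (q.snd - q.fst) • p.fst := rfl

theorem planeEmbedding_snd (p : WithLp 2 (V × V)) (q : Plane) :
    (planeEmbedding p q).snd = (q.snd + q.fst) • p.snd := rfl

theorem setOf_norm_eq_inter_sphere {V : Type} [NormedAddCommGroup V] :
    {p : WithLp 2 (V × V) | ‖p.fst‖ = ‖p.snd‖} ∩ sphere (0 : WithLp 2 (V × V)) √2 =
      {p | ‖p.fst‖ = 1 ∧ ‖p.snd‖ = 1} := by
  ext p
  have h := WithLp.prod_norm_sq_eq_of_L2 p
  simp only [mem_inter_iff, mem_ofPred_eq, mem_sphere_iff_norm, sub_zero]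
  constructor
  · rintro ⟨h1, h2⟩
    rw [h2, Real.sq_sqrt zero_le_two, ← h1] at h
    have h3 : ‖p.fst‖ = 1 :=
      (pow_eq_one_iff_of_nonneg (norm_nonneg _) two_ne_zero).1 (by linarith)
    exact ⟨h3, h1 ▸ h3⟩
  · rintro ⟨h1, h2⟩
    refine ⟨h1.trans h2.symm, ?_⟩
    rw [h1, h2] at h
    rw [← Real.sqrt_sq (norm_nonneg p), h]
    norm_num

/-- The integrand: uniformly convex, `C¹`, and smooth exactly off the set `|p₁| = |p₂| = 1`. Where
`(|p₂| ∓ |p₁|) / 2` are cubes `s³`, `t³` with `s² + t² = 1` its gradient is explicit. -/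
theorem exists_integrand [FiniteDimensional ℝ V] {a : ℝ} (ha : 3 / 2 ≤ a) :
    ∃ F : WithLp 2 (V × V) → ℝ,
    (∃ m : ℝ, 0 < m ∧ StrongConvexOn univ m F) ∧ ContDiff ℝ 1 F ∧
    ContDiffOn ℝ ∞ F (degeneracySet F)ᶜ ∧
    degeneracySet F = {p | ‖p.fst‖ = 1 ∧ ‖p.snd‖ = 1} ∧
    ∀ p : WithLp 2 (V × V), p.fst ≠ 0 → p.snd ≠ 0 → ∀ s t : ℝ, s ^ 2 + t ^ 2 = 1 →
      (‖p.snd‖ - ‖p.fst‖) / 2 = s ^ 3 → (‖p.snd‖ + ‖p.fst‖) / 2 = t ^ 3 →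
      ∇ F p = WithLp.toLp 2
        (((profilePoly a t - profilePoly a s) / 2 / ‖p.fst‖ + 1 / 20) • p.fst,
          ((profilePoly a t + profilePoly a s) / 2 / ‖p.snd‖ + 1 / 20) • p.snd) := by
  obtain ⟨G, G', hG, hG'c, hconv, hsm, hcusp, hswap, hneg, hval⟩ := exists_planar_integrand ha
  have hGf : ∀ p, HasFDerivAt G (InnerProductSpace.toDual ℝ Plane (G' p)) p :=
    fun p => (hG p).hasFDerivAt
  have hG1 : ContDiff ℝ 1 G := contDiff_one_iff_hasFDerivAt.2
    ⟨fun p => InnerProductSpace.toDual ℝ Plane (G' p),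
      (InnerProductSpace.toDual ℝ Plane).continuous.comp hG'c, hGf⟩
  set f := rotated G with hf
  have hfG : f = G ∘ planeTurn := rotated_eq_comp G
  have he₁ : ∀ r s, f (-r, s) = f (r, s) := by
    intro r s
    simp only [hf, rotated, sub_neg_eq_add, ← sub_eq_add_neg]
    exact hswap _ _
  have he₂ : ∀ r s, f (r, -s) = f (r, s) := by
    intro r s
    simp only [hf, rotated]
    rw [← hswap, ← hneg]
    congr 1
    apply plane_ext <;> simp <;> ring
  have hf1 : ContDiff ℝ 1 f := hfG ▸ hG1.comp planeTurn.contDiff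
  have hfc : ConvexOn ℝ univ f := by
    have h := hconv.comp_linearMap planeTurn.toLinearMap
    rw [hfG]
    exact h
  have hcuspc : IsOpen cuspSetᶜ := by
    rw [isOpen_compl_iff]
    have h1 : Continuous fun p : Plane => p.fst := (WithLp.fstL 2 ℝ ℝ ℝ).continuous
    have h2 : Continuous fun p : Plane => p.snd := (WithLp.sndL 2 ℝ ℝ ℝ).continuous
    exact (isClosed_eq (h1.mul h2) continuous_const).inter
      (isClosed_eq ((h1.pow 2).add (h2.pow 2)) continuous_const)
  have hfs : ∀ q : ℝ × ℝ, ¬ (q.1 ^ 2 = 1 ∧ q.2 ^ 2 = 1) → ContDiffAt ℝ ∞ f q := by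
    intro q hq
    rw [hfG]
    refine ContDiffAt.comp q (hsm.contDiffAt (hcuspc.mem_nhds ?_)) planeTurn.contDiff.contDiffAt
    rw [planeTurn_apply]
    rintro ⟨h1, h2⟩
    simp only [planePt_fst, planePt_snd] at h1 h2
    exact hq ⟨by nlinarith, by nlinarith⟩
  -- In the rotated coordinates the added term is `(u² + v²) / 20`, with gradient `(s³, t³) / 10`
  -- along the astroid.
  set F : WithLp 2 (V × V) → ℝ := fun p => normLift f p + 1 / 40 * ‖p‖ ^ 2 with hF
  have hquad : ContDiff ℝ ∞ fun p : WithLp 2 (V × V) => (1 / 40 : ℝ) * ‖p‖ ^ 2 :=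
    contDiff_const.mul (contDiff_norm_sq ℝ)
  have hsc : StrongConvexOn univ (1 / 20) F := by
    rw [strongConvexOn_iff_convex]
    have h : ConvexOn ℝ univ (normLift f : WithLp 2 (V × V) → ℝ) := hfc.normLift he₁ he₂
    have he : (fun p => F p - 1 / 20 / 2 * ‖p‖ ^ 2) = normLift f := by
      ext p
      change normLift f p + 1 / 40 * ‖p‖ ^ 2 - 1 / 20 / 2 * ‖p‖ ^ 2 = normLift f p
      ring
    rwa [he]
  have hFs : ∀ p : WithLp 2 (V × V), ¬ (‖p.fst‖ = 1 ∧ ‖p.snd‖ = 1) → ContDiffAt ℝ ∞ F p :=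
    fun p hp => (contDiffAt_normLift hfs he₁ he₂ hp).add hquad.contDiffAt
  have hF1 : ContDiff ℝ 1 F := by
    rw [contDiff_iff_contDiffAt]
    intro p
    by_cases hp : ‖p.fst‖ = 1 ∧ ‖p.snd‖ = 1
    · refine ContDiffAt.add (contDiffAt_normLift_of_ne_zero (k := 1) hf1 ?_ ?_)
        (hquad.contDiffAt.of_le (by simp))
      · rw [← norm_ne_zero_iff, hp.1]; exact one_ne_zero
      · rw [← norm_ne_zero_iff, hp.2]; exact one_ne_zero
    · exact (hFs p hp).of_le (by simp)
  have hFd : Differentiable ℝ F := hF1.differentiable one_ne_zero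
  have hdeg : degeneracySet F = {p | ‖p.fst‖ = 1 ∧ ‖p.snd‖ = 1} := by
    ext p
    rw [← not_iff_not, notMem_degeneracySet_iff_differentiableAt (by norm_num) hsc hFd,
      mem_ofPred_eq]
    refine ⟨?_, fun hp => ((hFs p hp).fderiv_right (m := 1)
      (WithTop.coe_le_coe.2 le_top)).differentiableAt one_ne_zero⟩
    rintro hp ⟨h1, h2⟩
    -- On the plane through `p₁` and `p₂` the integrand is `G` plus a quadratic function.
    set ι := planeEmbedding p with hι
    have hGF : ∀ q, G q = F (ι q) - 1 / 20 * ‖q‖ ^ 2 := by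
      intro q
      have hn1 : ‖(ι q).fst‖ = |q.snd - q.fst| := by
        rw [hι, planeEmbedding_fst, norm_smul, h1, mul_one, Real.norm_eq_abs]
      have hn2 : ‖(ι q).snd‖ = |q.snd + q.fst| := by
        rw [hι, planeEmbedding_snd, norm_smul, h2, mul_one, Real.norm_eq_abs]
      have habs₁ : ∀ r s, f (|r|, s) = f (r, s) := by
        intro r s
        rcases abs_choice r with h | h <;> rw [h]
        exact he₁ r s
      have habs₂ : ∀ r s, f (r, |s|) = f (r, s) := by
        intro r s
        rcases abs_choice s with h | h <;> rw [h]
        exact he₂ r s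
      simp only [hF, normLift, hn1, hn2, habs₁, habs₂, WithLp.prod_norm_sq_eq_of_L2 (ι q), sq_abs,
        plane_norm_sq q]
      have : f (q.snd - q.fst, q.snd + q.fst) = G q := by
        simp only [hf, rotated]
        congr 1
        apply plane_ext <;> simp
      rw [this]
      ring
    have hιp : ι (planePt 0 1) = p := by
      apply WithLp.ofLp_injective 2
      refine Prod.ext ?_ ?_
      · exact (planeEmbedding_fst p _).trans (by simp)
      · exact (planeEmbedding_snd p _).trans (by simp)
    have hder : ∀ q, fderiv ℝ G q = (fderiv ℝ F (ι q)).comp ι - (1 / 10 : ℝ) • innerSL ℝ q := by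
      intro q
      have h3 := (hFd (ι q)).hasFDerivAt.comp q ι.hasFDerivAt
      have h4 := (hasStrictFDerivAt_norm_sq q).hasFDerivAt.const_mul (1 / 20 : ℝ)
      have h5 : HasFDerivAt G _ q := (h3.sub h4).congr_of_eventuallyEq (.of_forall hGF)
      rw [h5.fderiv]
      ext v
      simp
      ring
    have hdiff : DifferentiableAt ℝ (fderiv ℝ G) (planePt 0 1) := by
      rw [funext hder]
      refine DifferentiableAt.sub ?_
        (((innerSL ℝ).differentiableAt (x := planePt 0 1)).const_smul (1 / 10 : ℝ))
      have h3 : DifferentiableAt ℝ (fun q => fderiv ℝ F (ι q)) (planePt 0 1) :=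
        DifferentiableAt.comp (g := fderiv ℝ F) (planePt 0 1) (hιp.symm ▸ hp) ι.differentiableAt
      exact h3.clm_comp (differentiableAt_const _)
    refine hcusp (planePt 0 1) (by simp [cuspSet]) ?_
    have hG'eq : G' = fun q => (InnerProductSpace.toDual ℝ Plane).symm (fderiv ℝ G q) := by
      ext1 q
      rw [(hGf q).fderiv, LinearIsometryEquiv.symm_apply_apply]
    rw [hG'eq]
    exact (InnerProductSpace.toDual ℝ Plane).symm.toContinuousLinearEquiv.differentiableAt.comp
      _ hdiff
  refine ⟨F, ⟨1 / 20, by norm_num, hsc⟩, hF1, ?_, hdeg, ?_⟩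
  · rw [hdeg]
    exact fun p hp => (hFs p hp).contDiffWithinAt
  · intro p hp1 hp2 s t hst hs ht
    apply HasGradientAt.gradient
    rw [hasGradientAt_iff_hasFDerivAt]
    have h1 := (hasFDerivAt_norm_of_ne_zero hp1).comp p (WithLp.fstL 2 ℝ V V).hasFDerivAt
    have h2 := (hasFDerivAt_norm_of_ne_zero hp2).comp p (WithLp.sndL 2 ℝ V V).hasFDerivAt
    have hrot : planeTurn (‖p.fst‖, ‖p.snd‖) = planePt (s ^ 3) (t ^ 3) := by
      rw [planeTurn_apply, ← hs, ← ht]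
    have h3 := ((hGf (planeTurn (‖p.fst‖, ‖p.snd‖))).comp _ planeTurn.hasFDerivAt).comp p
      (h1.prodMk h2)
    have h4 := h3.add ((hasStrictFDerivAt_norm_sq p).hasFDerivAt.const_mul (1 / 40 : ℝ))
    have hFe : ∀ q, F q = G (planeTurn (‖q.fst‖, ‖q.snd‖)) + 1 / 40 * ‖q‖ ^ 2 := by
      intro q
      rw [planeTurn_apply]
      rfl
    have h5 := h4.congr_of_eventuallyEq (f₁ := F) (.of_forall hFe)
    refine h5.congr_fderiv ?_
    ext v
    rw [hrot, hval s t hst]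
    have e1 : ‖p.fst‖ ≠ 0 := norm_ne_zero_iff.2 hp1
    have e2 : ‖p.snd‖ ≠ 0 := norm_ne_zero_iff.2 hp2
    simp [planeTurn_apply, WithLp.prod_inner_apply, inner_smul_left]
    field_simp
    ring

end Integrand

/-! ### Weak gradients of Lipschitz functions -/

section WeakGradient

variable {E : Type*} [NormedAddCommGroup E] [InnerProductSpace ℝ E] [FiniteDimensional ℝ E]

theorem norm_gradient_le_of_lipschitz {u : E → ℝ} {K : ℝ≥0} (hu : LipschitzWith K u) (x : E) :
    ‖∇ u x‖ ≤ K := by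
  rw [gradient, LinearIsometryEquiv.norm_map]
  exact norm_fderiv_le_of_lipschitz ℝ hu

theorem gradient_eq_zero_of_notMem_tsupport {φ : E → ℝ} {x : E} (hx : x ∉ tsupport φ) :
    ∇ φ x = 0 := by
  rw [(notMem_tsupport_iff_eventuallyEq.1 hx).gradient_eq]
  exact gradient_fun_const x 0

theorem IsTestFunction.gradient_eq_zero {k : ℕ∞} {U : Set E} {φ : E → ℝ}
    (hφ : IsTestFunction k U φ) {x : E} (hx : x ∉ U) : ∇ φ x = 0 :=
  gradient_eq_zero_of_notMem_tsupport fun h => hx (hφ.tsupport_subset h)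

theorem continuous_gradient {φ : E → ℝ} (hφ : ContDiff ℝ 1 φ) : Continuous (∇ φ) :=
  (InnerProductSpace.toDual ℝ E).symm.continuous.comp (hφ.continuous_fderiv one_ne_zero)

theorem ConvexOn.add_inner_gradient_le {F : E → ℝ} (hF : ConvexOn ℝ univ F)
    (hd : Differentiable ℝ F) (p q : E) : F p + ⟪∇ F p, q⟫ ≤ F (p + q) := by
  have hline : HasDerivAt (fun t : ℝ => p + t • q) q 0 := by
    simpa using ((hasDerivAt_id (0 : ℝ)).smul_const q).const_add p
  have hconv : ConvexOn ℝ univ fun t : ℝ => F (p + t • q) := by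
    have h := hF.comp_affineMap (AffineMap.lineMap p (p + q) : ℝ →ᵃ[ℝ] E)
    have he : (fun t : ℝ => F (p + t • q)) =
        F ∘ (AffineMap.lineMap p (p + q) : ℝ →ᵃ[ℝ] E) := by
      ext t
      simp [AffineMap.lineMap_apply, add_comm]
    rw [he]
    exact h
  have hder : HasDerivAt (fun t : ℝ => F (p + t • q)) (fderiv ℝ F p q) 0 := by
    have h := (hd (p + (0 : ℝ) • q)).hasFDerivAt.comp_hasDerivAt 0 hline
    exact h.congr_deriv (by simp)
  have h := hconv.le_slope_of_hasDerivAt (mem_univ 0) (mem_univ 1) one_pos hder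
  simp only [slope_def_field, one_smul, zero_smul, add_zero, sub_zero, div_one] at h
  rw [inner_gradient_left]
  linarith

variable [MeasurableSpace E] [BorelSpace E]

theorem measurable_gradient (u : E → ℝ) : Measurable (∇ u) :=
  (InnerProductSpace.toDual ℝ E).symm.continuous.measurable.comp (measurable_fderiv ℝ u)

theorem memLp_top_gradient {u : E → ℝ} {K : ℝ≥0} (hu : LipschitzWith K u) (μ : Measure E) :
    MemLp (∇ u) ∞ μ :=
  memLp_top_of_bound (measurable_gradient u).aestronglyMeasurable K
    (.of_forall (norm_gradient_le_of_lipschitz hu))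

/-- By Rademacher's theorem the pointwise gradient of a Lipschitz function is its weak
gradient. -/
theorem LipschitzWith.isWeakGradient {u : E → ℝ} {K : ℝ≥0} (hu : LipschitzWith K u) (U : Set E) :
    IsWeakGradient U u (∇ u) where
  locallyIntegrableOn := hu.continuous.locallyIntegrable.locallyIntegrableOn U
  locallyIntegrableOn_grad :=
    ((memLp_top_gradient hu volume).locallyIntegrable le_top).locallyIntegrableOn U
  integral_eq := by
    intro φ hφ v
    obtain ⟨D, hD⟩ := hφ.contDiff.lipschitzWith_of_hasCompactSupport hφ.hasCompactSupport (by simp)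
    have h0 : ∀ x ∉ U, φ x = 0 := fun x hx =>
      image_eq_zero_of_notMem_tsupport fun h' => hx (hφ.tsupport_subset h')
    rw [setIntegral_eq_integral_of_forall_compl_eq_zero fun x hx => by
        rw [← inner_gradient_left, hφ.gradient_eq_zero hx, inner_zero_left, mul_zero],
      setIntegral_eq_integral_of_forall_compl_eq_zero fun x hx => by rw [h0 x hx, zero_mul]]
    have h := hu.integral_lineDeriv_mul_eq (μ := volume) hD hφ.hasCompactSupport v
    have h1 : ∫ x, lineDeriv ℝ u x v * φ x = ∫ x, φ x * ⟪∇ u x, v⟫ := by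
      refine integral_congr_ae ?_
      filter_upwards [hu.ae_differentiableAt (μ := volume)] with x hx
      rw [hx.lineDeriv_eq_fderiv, inner_gradient_left, mul_comm]
    have h2 : ∫ x, lineDeriv ℝ φ x (-v) * u x = -∫ x, u x * fderiv ℝ φ x v := by
      rw [← integral_neg]
      congr 1
      ext x
      rw [((hφ.contDiff.differentiable (by simp)) x).lineDeriv_eq_fderiv, map_neg]
      ring
    rw [← h1, h, h2, neg_neg]

theorem LipschitzWith.memW1Infty {u : E → ℝ} {K : ℝ≥0} (hu : LipschitzWith K u) {U : Set E}
    (hU : IsOpen U) (hb : Bornology.IsBounded U) : MemW1Infty U u := by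
  refine ⟨?_, ∇ u, hu.isWeakGradient U, memLp_top_gradient hu _⟩
  obtain ⟨C, hC⟩ := (hb.isCompact_closure.image hu.continuous).isBounded.exists_norm_le
  refine memLp_top_of_bound hu.continuous.aestronglyMeasurable C ?_
  filter_upwards [ae_restrict_mem hU.measurableSet] with x hx
  exact hC _ (mem_image_of_mem u (subset_closure hx))

theorem LipschitzWith.weakGrad_ae_eq {u : E → ℝ} {K : ℝ≥0} (hu : LipschitzWith K u) {U : Set E}
    (hU : IsOpen U) : weakGrad U u =ᵐ[volume.restrict U] ∇ u := by
  have h : ∃ g, IsWeakGradient U u g := ⟨_, hu.isWeakGradient U⟩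
  rw [weakGrad, dif_pos h]
  exact h.choose_spec.ae_eq hU (hu.isWeakGradient U)

theorem LipschitzWith.energy_eq {u : E → ℝ} {K : ℝ≥0} (hu : LipschitzWith K u) (F : E → ℝ) :
    energy F u = ∫ x in ball (0 : E) 1, F (∇ u x) := by
  refine integral_congr_ae ?_
  filter_upwards [hu.weakGrad_ae_eq isOpen_ball] with x hx
  rw [hx]

/-- A continuous function of a bounded measurable field is integrable on bounded sets. -/
theorem integrableOn_comp_of_bounded {G : Type*} [NormedAddCommGroup G] {f : E → G}
    (hf : Continuous f) {Y : E → E} (hY : Measurable Y) {C : ℝ} (hC : ∀ x, ‖Y x‖ ≤ C) :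
    IntegrableOn (fun x => f (Y x)) (ball (0 : E) 1) := by
  obtain ⟨M, hM⟩ := ((isCompact_closedBall (0 : E) C).image hf).isBounded.exists_norm_le
  refine IntegrableOn.of_bound measure_ball_lt_top
    (hf.comp_stronglyMeasurable hY.stronglyMeasurable).aestronglyMeasurable M
    (.of_forall fun x => ?_)
  exact hM _ (mem_image_of_mem f (by simpa using hC x))

/-- A Lipschitz weak solution of the Euler–Lagrange equation of a convex integrand minimizes. -/
theorem IsLipschitzWeakSolution.isLipschitzMinimizer {F u : E → ℝ} (hF : ConvexOn ℝ univ F)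
    (hF1 : ContDiff ℝ 1 F) {K : ℝ≥0} (hu : LipschitzWith K u)
    (hw : IsLipschitzWeakSolution F u) : IsLipschitzMinimizer F u := by
  refine ⟨hw.1, fun φ hφ => ?_⟩
  obtain ⟨D, hD⟩ := hφ.contDiff.lipschitzWith_of_hasCompactSupport hφ.hasCompactSupport
    (by simp)
  have huφ : LipschitzWith (K + D) (u + φ) := hu.add hD
  rw [hu.energy_eq, huφ.energy_eq]
  have h0 : ∫ x in ball (0 : E) 1, ⟪∇ F (∇ u x), ∇ φ x⟫ = 0 := by
    rw [← hw.2 φ hφ]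
    refine integral_congr_ae ?_
    filter_upwards [hu.weakGrad_ae_eq isOpen_ball] with x hx
    rw [hx]
  have hi1 := integrableOn_comp_of_bounded hF1.continuous (measurable_gradient u)
    (norm_gradient_le_of_lipschitz hu)
  have hi2 := integrableOn_comp_of_bounded hF1.continuous (measurable_gradient (u + φ))
    (norm_gradient_le_of_lipschitz huφ)
  have hi3 : IntegrableOn (fun x => ⟪∇ F (∇ u x), ∇ φ x⟫) (ball (0 : E) 1) := by
    have h := integrableOn_comp_of_bounded (continuous_gradient hF1) (measurable_gradient u)
      (norm_gradient_le_of_lipschitz hu)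
    refine (h.norm.mul_const (D : ℝ)).mono'
      (h.aestronglyMeasurable.inner (measurable_gradient φ).aestronglyMeasurable)
      (.of_forall fun x => ?_)
    exact (norm_inner_le_norm _ _).trans
      (mul_le_mul_of_nonneg_left (norm_gradient_le_of_lipschitz hD x) (norm_nonneg _))
  calc ∫ x in ball (0 : E) 1, F (∇ u x)
      = ∫ x in ball (0 : E) 1, (F (∇ u x) + ⟪∇ F (∇ u x), ∇ φ x⟫) := by
        rw [integral_add hi1 hi3, h0, add_zero]
    _ ≤ ∫ x in ball (0 : E) 1, F (∇ (u + φ) x) := by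
        refine integral_mono_ae (hi1.add hi3) hi2 ?_
        filter_upwards [ae_restrict_of_ae (hu.ae_differentiableAt (μ := volume))] with x hx
        have hφx : DifferentiableAt ℝ φ x := (hφ.contDiff.differentiable (by simp)) x
        have hg : ∇ (u + φ) x = ∇ u x + ∇ φ x := by
          refine HasGradientAt.gradient ?_
          rw [hasGradientAt_iff_hasFDerivAt, map_add]
          exact hx.hasGradientAt.hasFDerivAt.add hφx.hasGradientAt.hasFDerivAt
        simp only [hg]
        exact hF.add_inner_gradient_le (hF1.differentiable one_ne_zero) _ _

end WeakGradient

/-! ### Divergence-free fields with an isolated singularity -/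

section Divergence

variable {E : Type*} [NormedAddCommGroup E] [InnerProductSpace ℝ E] [FiniteDimensional ℝ E]
  [MeasurableSpace E] [BorelSpace E]

/-- Integration by parts; the divergence is the trace of the derivative. -/
theorem integral_inner_gradient_eq {Y : E → E} (hY : ContDiff ℝ 1 Y) {φ : E → ℝ}
    (hφ : ContDiff ℝ 1 φ) (hc : HasCompactSupport φ) :
    ∫ x, ⟪Y x, ∇ φ x⟫ = -∫ x, φ x * LinearMap.trace ℝ E (fderiv ℝ Y x) := by
  set b := stdOrthonormalBasis ℝ E
  have hYd := hY.differentiable one_ne_zero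
  have hφd := hφ.differentiable one_ne_zero
  have hcomp : ∀ i, ContDiff ℝ 1 fun x => ⟪b i, Y x⟫ := fun i => contDiff_const.inner ℝ hY
  have hder : ∀ i x, fderiv ℝ (fun x => ⟪b i, Y x⟫) x (b i) = ⟪b i, fderiv ℝ Y x (b i)⟫ := by
    intro i x
    rw [fderiv_inner_apply ℝ (differentiableAt_const _) (hYd x)]
    simp
  have hYf : Continuous (fderiv ℝ Y) := hY.continuous_fderiv one_ne_zero
  have hφf : Continuous (fderiv ℝ φ) := hφ.continuous_fderiv one_ne_zero
  have hi1 : ∀ i, Integrable (fun x => ⟪b i, Y x⟫ * fderiv ℝ φ x (b i)) := fun i =>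
    ((hcomp i).continuous.mul (hφf.clm_apply continuous_const)).integrable_of_hasCompactSupport
      ((hc.fderiv_apply (𝕜 := ℝ) (b i)).mul_left)
  have hi2 : ∀ i, Integrable (fun x => ⟪b i, fderiv ℝ Y x (b i)⟫ * φ x) := fun i =>
    ((continuous_const.inner (hYf.clm_apply continuous_const)).mul
      hφ.continuous).integrable_of_hasCompactSupport hc.mul_left
  have hparts : ∀ i, ∫ x, ⟪b i, Y x⟫ * fderiv ℝ φ x (b i) =
      -∫ x, ⟪b i, fderiv ℝ Y x (b i)⟫ * φ x := by
    intro i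
    rw [integral_mul_fderiv_eq_neg_fderiv_mul_of_integrable]
    · simp only [hder]
    · simpa only [hder] using hi2 i
    · exact hi1 i
    · exact ((hcomp i).continuous.mul hφ.continuous).integrable_of_hasCompactSupport hc.mul_left
    · exact fun x _ => (hcomp i).differentiable one_ne_zero x
    · exact fun x _ => hφd x
  have h1 : ∀ x, ⟪Y x, ∇ φ x⟫ = ∑ i, ⟪b i, Y x⟫ * fderiv ℝ φ x (b i) := by
    intro x
    rw [← b.sum_inner_mul_inner]
    refine Finset.sum_congr rfl fun i _ => ?_
    rw [real_inner_comm, real_inner_comm (∇ φ x), inner_gradient_left]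
  have h2 : ∀ x, φ x * LinearMap.trace ℝ E (fderiv ℝ Y x) =
      ∑ i, ⟪b i, fderiv ℝ Y x (b i)⟫ * φ x := by
    intro x
    rw [LinearMap.trace_eq_sum_inner _ b, Finset.mul_sum]
    exact Finset.sum_congr rfl fun i _ => mul_comm _ _
  simp only [h1, h2]
  rw [integral_finsetSum _ fun i _ => hi1 i, integral_finsetSum _ fun i _ => hi2 i,
    ← Finset.sum_neg_distrib]
  exact Finset.sum_congr rfl fun i _ => hparts i

/-- A point is removable for bounded divergence-free fields in dimension at least two: a cutoff at
scale `r` contributes at most a multiple of `r⁻¹ r ^ dim E`. -/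
theorem integral_inner_gradient_eq_zero (hdim : 2 ≤ Module.finrank ℝ E) {X : E → E}
    (hXm : Measurable X) {M : ℝ} (hM : ∀ x, ‖X x‖ ≤ M) (hX : ∀ x ≠ 0, ContDiffAt ℝ 1 X x)
    (htr : ∀ x ≠ 0, LinearMap.trace ℝ E (fderiv ℝ X x) = 0) {φ : E → ℝ} (hφ : ContDiff ℝ 1 φ)
    (hc : HasCompactSupport φ) : ∫ x, ⟪X x, ∇ φ x⟫ = 0 := by
  have : Nontrivial E := Module.nontrivial_of_finrank_pos (R := ℝ) (by omega)
  have hM0 : 0 ≤ M := (norm_nonneg _).trans (hM 0)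
  set ψ : ℝ → ℝ := fun t => Real.smoothTransition (t - 1) with hψ
  have hψs : ContDiff ℝ ∞ ψ := Real.smoothTransition.contDiff.comp (by fun_prop)
  have hψ0 : ∀ t ≤ 1, ψ t = 0 := fun t ht => Real.smoothTransition.zero_of_nonpos (by linarith)
  have hψ1 : ∀ t, 2 ≤ t → ψ t = 1 := fun t ht => Real.smoothTransition.one_of_one_le (by linarith)
  obtain ⟨L, hL⟩ : ∃ L, ∀ t, |deriv ψ t| ≤ L := by
    obtain ⟨L, hL⟩ := (isCompact_Icc (a := (1 : ℝ)) (b := 2)).exists_bound_of_continuousOn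
      (hψs.continuous_deriv (by simp)).continuousOn
    refine ⟨max L 0, fun t => ?_⟩
    rcases lt_or_ge t 1 with h | h
    · have : ψ =ᶠ[nhds t] fun _ => 0 := by
        filter_upwards [eventually_lt_nhds h] with s hs using hψ0 s hs.le
      rw [this.deriv_eq]
      simp
    · rcases le_or_gt t 2 with h' | h'
      · exact (hL t ⟨h, h'⟩).trans (le_max_left _ _)
      · have : ψ =ᶠ[nhds t] fun _ => 1 := by
          filter_upwards [eventually_gt_nhds h'] with s hs using hψ1 s hs.le
        rw [this.deriv_eq]
        simp
  have hL0 : 0 ≤ L := (abs_nonneg _).trans (hL 0)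
  obtain ⟨N, hN⟩ := hc.exists_bound_of_continuous hφ.continuous
  have hN0 : 0 ≤ N := (norm_nonneg _).trans (hN 0)
  -- The cutoff vanishes on `|x| ≤ r` and equals `1` on `|x|² ≥ 2 r²`.
  set η : ℝ → E → ℝ := fun r x => ψ (‖x‖ ^ 2 / r ^ 2) with hη
  have hηs : ∀ r, ContDiff ℝ ∞ (η r) := fun r =>
    hψs.comp ((contDiff_norm_sq ℝ).div_const _)
  have hηd : ∀ r x v, fderiv ℝ (η r) x v = deriv ψ (‖x‖ ^ 2 / r ^ 2) * (2 * ⟪x, v⟫ / r ^ 2) := by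
    intro r x v
    have h1 := (hasStrictFDerivAt_norm_sq x).hasFDerivAt.mul_const (r ^ 2)⁻¹
    have h2 :=
      ((hψs.differentiable (by simp)) (‖x‖ ^ 2 * (r ^ 2)⁻¹)).hasDerivAt.comp_hasFDerivAt x h1
    have h3 : HasFDerivAt (η r) _ x := h2
    rw [h3.fderiv]
    change deriv ψ (‖x‖ ^ 2 * (r ^ 2)⁻¹) * ((r ^ 2)⁻¹ * (2 • ⟪x, v⟫)) = _
    rw [div_eq_mul_inv, div_eq_mul_inv, nsmul_eq_mul]
    push_cast
    ring
  set V : ℝ := volume.real (ball (0 : E) 1) with hV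
  set d := Module.finrank ℝ E with hd
  -- The identity for the field cut off near the origin, and the bound of its right-hand side.
  have hcut : ∀ r : ℝ, 0 < r → r ≤ 1 →
      |∫ x, η r x * ⟪X x, ∇ φ x⟫| ≤ N * L * (4 * M / r) * ((2 * r) ^ d * V) := by
    intro r hr hr1
    set Y : E → E := fun x => η r x • X x with hY
    have hnear : ∀ x : E, ‖x‖ < r → η r x = 0 := by
      intro x hx
      apply hψ0
      rw [div_le_one (by positivity)]
      exact pow_le_pow_left₀ (norm_nonneg _) hx.le 2
    have hYc : ContDiff ℝ 1 Y := by
      rw [contDiff_iff_contDiffAt]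
      intro x
      by_cases hx : x = 0
      · have hev : ∀ᶠ y : E in nhds x, ‖y‖ < r :=
          continuous_norm.continuousAt.eventually_lt continuousAt_const (by simpa [hx])
        refine (contDiffAt_const (c := (0 : E))).congr_of_eventuallyEq ?_
        filter_upwards [hev] with y hy
        simp only [hY, hnear y hy, zero_smul]
      · exact ((hηs r).contDiffAt.of_le (by simp)).smul (hX x hx)
    have htrY : ∀ x, LinearMap.trace ℝ E (fderiv ℝ Y x) = fderiv ℝ (η r) x (X x) := by
      intro x
      by_cases hx : x = 0
      · have hev : ∀ᶠ y : E in nhds x, ‖y‖ < r :=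
          continuous_norm.continuousAt.eventually_lt continuousAt_const (by simpa [hx])
        have h1 : Y =ᶠ[nhds x] fun _ => 0 := by
          filter_upwards [hev] with y hy
          simp only [hY, hnear y hy, zero_smul]
        rw [h1.fderiv_eq, hηd, hx]
        simp
      · have hXd := (hX x hx).differentiableAt one_ne_zero
        have hηx := (hηs r).differentiable (by simp) x
        have h1 : fderiv ℝ Y x = η r x • fderiv ℝ X x + (fderiv ℝ (η r) x).smulRight (X x) :=
          (hηx.hasFDerivAt.smul hXd.hasFDerivAt).fderiv
        have h2 : ((fderiv ℝ Y x : E →L[ℝ] E) : E →ₗ[ℝ] E) =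
            η r x • ((fderiv ℝ X x : E →L[ℝ] E) : E →ₗ[ℝ] E) +
              ((fderiv ℝ (η r) x : E →L[ℝ] ℝ) : E →ₗ[ℝ] ℝ).smulRight (X x) := by
          rw [h1]; rfl
        rw [h2, map_add, map_smul, htr x hx, smul_zero, zero_add, LinearMap.trace_smulRight]
        rfl
    have h := integral_inner_gradient_eq hYc hφ hc
    have hYin : ∀ x, ⟪Y x, ∇ φ x⟫ = η r x * ⟪X x, ∇ φ x⟫ := fun x => real_inner_smul_left _ _ _
    simp only [hYin, htrY] at h
    rw [h, abs_neg]
    have hbound : ∀ x, ‖φ x * fderiv ℝ (η r) x (X x)‖ ≤ N * L * (4 * M / r) := by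
      intro x
      have hsm : |fderiv ℝ (η r) x (X x)| ≤ L * (4 * M / r) := by
        rw [hηd, abs_mul]
        by_cases hx : ‖x‖ < 2 * r
        · refine mul_le_mul (hL _) ?_ (abs_nonneg _) hL0
          rw [abs_div, abs_of_nonneg (sq_nonneg r), div_le_div_iff₀ (by positivity) hr, abs_mul,
            abs_two]
          have h1 := abs_real_inner_le_norm x (X x)
          have h2 : ‖x‖ * ‖X x‖ ≤ 2 * r * M :=
            mul_le_mul hx.le (hM x) (norm_nonneg _) (by positivity)
          nlinarith
        · have : ψ =ᶠ[nhds (‖x‖ ^ 2 / r ^ 2)] fun _ => 1 := by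
            have h4 : 2 < ‖x‖ ^ 2 / r ^ 2 := by
              rw [lt_div_iff₀ (by positivity)]
              push Not at hx
              nlinarith
            filter_upwards [eventually_gt_nhds h4] with s hs using hψ1 s hs.le
          rw [this.deriv_eq]
          simp
          positivity
      rw [norm_mul, mul_assoc]
      exact mul_le_mul (hN x) hsm (norm_nonneg _) hN0
    have hsupp : ∀ x ∉ ball (0 : E) (2 * r), φ x * fderiv ℝ (η r) x (X x) = 0 := by
      intro x hx
      have : ψ =ᶠ[nhds (‖x‖ ^ 2 / r ^ 2)] fun _ => 1 := by
        have h4 : 2 < ‖x‖ ^ 2 / r ^ 2 := by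
          rw [lt_div_iff₀ (by positivity)]
          rw [mem_ball_zero_iff] at hx
          push Not at hx
          nlinarith
        filter_upwards [eventually_gt_nhds h4] with s hs using hψ1 s hs.le
      rw [hηd, this.deriv_eq]
      simp
    rw [← setIntegral_eq_integral_of_forall_compl_eq_zero hsupp]
    refine (norm_setIntegral_le_of_norm_le_const measure_ball_lt_top
      fun x _ => hbound x).trans_eq ?_
    congr 1
    rw [measureReal_def, Measure.addHaar_ball _ _ (by positivity), ENNReal.toReal_mul,
      ENNReal.toReal_ofReal (by positivity), hV, measureReal_def]
  -- Let the scale tend to zero.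
  set r : ℕ → ℝ := fun k => 1 / ((k : ℝ) + 1) with hr
  have hrpos : ∀ k, 0 < r k := fun k => by positivity
  have hr1 : ∀ k, r k ≤ 1 := fun k => by
    rw [hr, div_le_one (by positivity)]
    linarith [(Nat.cast_nonneg k : (0 : ℝ) ≤ k)]
  have hrlim : Filter.Tendsto r Filter.atTop (nhds 0) := tendsto_one_div_add_atTop_nhds_zero_nat
  have hgint : Integrable fun x => M * ‖∇ φ x‖ :=
    (((continuous_gradient hφ).norm).integrable_of_hasCompactSupport
      (HasCompactSupport.intro hc fun x hx => by
        rw [gradient_eq_zero_of_notMem_tsupport hx, norm_zero])).const_mul M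
  have hψle : ∀ t, |ψ t| ≤ 1 := fun t => by
    rw [abs_of_nonneg (Real.smoothTransition.nonneg _)]
    exact Real.smoothTransition.le_one _
  have hlim1 : Filter.Tendsto (fun k => ∫ x, η (r k) x * ⟪X x, ∇ φ x⟫) Filter.atTop
      (nhds (∫ x, ⟪X x, ∇ φ x⟫)) := by
    refine tendsto_integral_of_dominated_convergence (fun x => M * ‖∇ φ x‖) (fun k => ?_) hgint
      (fun k => .of_forall fun x => ?_) ?_
    · exact ((hηs _).continuous.measurable.mul
        (hXm.inner (measurable_gradient φ))).aestronglyMeasurable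
    · rw [norm_mul]
      refine (mul_le_mul (hψle _) (norm_inner_le_norm _ _) (norm_nonneg _) zero_le_one).trans ?_
      rw [one_mul]
      exact mul_le_mul_of_nonneg_right (hM x) (norm_nonneg _)
    · filter_upwards [compl_mem_ae_iff.2 (measure_singleton (0 : E))] with x hx
      have hx0 : 0 < ‖x‖ := norm_pos_iff.2 hx
      refine tendsto_const_nhds.congr' ?_
      have hev : ∀ᶠ k in Filter.atTop, r k < ‖x‖ / 2 := hrlim.eventually_lt_const (by positivity)
      filter_upwards [hev] with k hk
      have : η (r k) x = 1 := by
        apply hψ1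
        rw [le_div_iff₀ (by have := hrpos k; positivity)]
        nlinarith [hrpos k]
      rw [this, one_mul]
  have hlim2 : Filter.Tendsto (fun k => ∫ x, η (r k) x * ⟪X x, ∇ φ x⟫) Filter.atTop (nhds 0) := by
    refine squeeze_zero_norm (a := fun k => N * L * (4 * M) * 2 ^ d * V * r k) (fun k => ?_) ?_
    · refine (hcut (r k) (hrpos k) (hr1 k)).trans ?_
      have hV0 : 0 ≤ V := measureReal_nonneg
      have hpow : (r k) ^ d ≤ (r k) ^ 2 := pow_le_pow_of_le_one (hrpos k).le (hr1 k) hdim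
      have hr0 := (hrpos k).ne'
      calc N * L * (4 * M / r k) * ((2 * r k) ^ d * V)
          = N * L * (4 * M) * 2 ^ d * V * ((r k) ^ d / r k) := by rw [mul_pow]; field_simp
        _ ≤ N * L * (4 * M) * 2 ^ d * V * r k := by
          refine mul_le_mul_of_nonneg_left ?_ (by positivity)
          rw [div_le_iff₀ (hrpos k)]
          linarith [sq (r k)]
    · simpa using hrlim.const_mul (N * L * (4 * M) * 2 ^ d * V)
  exact tendsto_nhds_unique hlim1 hlim2

end Divergence

/-! ### The cone and its divergence-free field -/

section Cone

variable {V : Type} [NormedAddCommGroup V] [InnerProductSpace ℝ V]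

/-- The reflection `J (x₁, x₂) = (-x₁, x₂)`. -/
noncomputable def halfReflection (V : Type) [NormedAddCommGroup V] [InnerProductSpace ℝ V] :
    WithLp 2 (V × V) →L[ℝ] WithLp 2 (V × V) :=
  (WithLp.prodContinuousLinearEquiv 2 ℝ V V).symm.toContinuousLinearMap.comp
    ((-WithLp.fstL 2 ℝ V V).prod (WithLp.sndL 2 ℝ V V))

local notation "J" => halfReflection V

@[simp] theorem halfReflection_fst (x : WithLp 2 (V × V)) : (J x).fst = -x.fst := rfl

@[simp] theorem halfReflection_snd (x : WithLp 2 (V × V)) : (J x).snd = x.snd := rfl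

theorem inner_halfReflection_comm (x y : WithLp 2 (V × V)) : ⟪J x, y⟫ = ⟪x, J y⟫ := by
  simp [WithLp.prod_inner_apply]

theorem inner_halfReflection_halfReflection (x y : WithLp 2 (V × V)) : ⟪J x, J y⟫ = ⟪x, y⟫ := by
  simp [WithLp.prod_inner_apply]

theorem norm_halfReflection (x : WithLp 2 (V × V)) : ‖J x‖ = ‖x‖ := by
  rw [← sq_eq_sq₀ (norm_nonneg _) (norm_nonneg _), ← real_inner_self_eq_norm_sq,
    inner_halfReflection_halfReflection, real_inner_self_eq_norm_sq]

theorem inner_self_halfReflection (x : WithLp 2 (V × V)) :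
    ⟪x, J x⟫ = ‖x.snd‖ ^ 2 - ‖x.fst‖ ^ 2 := by
  simp only [WithLp.prod_inner_apply, WithLp.ofLp_fst, WithLp.ofLp_snd, halfReflection_fst,
    halfReflection_snd, inner_neg_right, real_inner_self_eq_norm_sq]
  ring

/-- Exchanging the two halves conjugates `J` to `-J`. -/
theorem trace_halfReflection [FiniteDimensional ℝ V] :
    LinearMap.trace ℝ (WithLp 2 (V × V)) (J : WithLp 2 (V × V) →ₗ[ℝ] WithLp 2 (V × V)) = 0 := by
  set e : WithLp 2 (V × V) ≃ₗ[ℝ] WithLp 2 (V × V) :=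
    (WithLp.linearEquiv 2 ℝ (V × V)).trans ((LinearEquiv.prodComm ℝ V V).trans
      (WithLp.linearEquiv 2 ℝ (V × V)).symm) with he
  have h := LinearMap.trace_conj' (J : WithLp 2 (V × V) →ₗ[ℝ] WithLp 2 (V × V)) e
  have h1 : e.conj (J : WithLp 2 (V × V) →ₗ[ℝ] WithLp 2 (V × V)) =
      -(J : WithLp 2 (V × V) →ₗ[ℝ] WithLp 2 (V × V)) := by
    ext x
    apply WithLp.ofLp_injective 2
    refine Prod.ext ?_ ?_
    · change x.fst = - -x.fst
      rw [neg_neg]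
    · rfl
  rw [h1, map_neg] at h
  linarith

/-- Half the quadratic form of `J`, that is `(|x₂|² - |x₁|²) / 2`. -/
noncomputable def saddle (x : WithLp 2 (V × V)) : ℝ := ⟪x, J x⟫ / 2

theorem hasFDerivAt_saddle (x : WithLp 2 (V × V)) : HasFDerivAt saddle (innerSL ℝ (J x)) x := by
  have h := ((hasFDerivAt_id x).inner ℝ (halfReflection V).hasFDerivAt).mul_const (1 / 2 : ℝ)
  have h' : HasFDerivAt (saddle (V := V)) _ x := h.congr_of_eventuallyEq
    (.of_forall fun y => by simp only [saddle, id]; ring)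
  refine h'.congr_fderiv ?_
  ext v
  simp only [innerSL_apply_apply, smul_apply, fderivInnerCLM_apply, ContinuousLinearMap.comp_apply,
    ContinuousLinearMap.prod_apply, ContinuousLinearMap.id_apply, id, smul_eq_mul]
  rw [← inner_halfReflection_comm x v, real_inner_comm (J x) v]
  ring

theorem contDiff_saddle : ContDiff ℝ ∞ (saddle (V := V)) :=
  (contDiff_id.inner ℝ (halfReflection V).contDiff).div_const 2

theorem hasFDerivAt_norm_inv {x : WithLp 2 (V × V)} (hx : x ≠ 0) :
    HasFDerivAt (fun x : WithLp 2 (V × V) => ‖x‖⁻¹) (-(‖x‖⁻¹ ^ 3) • innerSL ℝ x) x := by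
  have h := (hasDerivAt_inv (norm_ne_zero_iff.2 hx)).comp_hasFDerivAt x
    (hasFDerivAt_norm_of_ne_zero hx)
  refine HasFDerivAt.congr_fderiv (f' := _) h ?_
  ext v
  simp
  ring

theorem abs_saddle_le (x : WithLp 2 (V × V)) : |saddle x| ≤ ‖x‖ ^ 2 / 2 := by
  rw [saddle, abs_div, abs_two]
  have h := abs_real_inner_le_norm x (J x)
  rw [norm_halfReflection] at h
  linarith [sq ‖x‖]

/-- With `D` the saddle, the field
`a (5 / |x| - 4 D² / |x|⁵) J x + (9 D / |x|³ - 20 D³ / |x|⁷) x`. It is homogeneous of degree zero;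
its value at the origin is zero. -/
noncomputable def coneField (a : ℝ) (x : WithLp 2 (V × V)) : WithLp 2 (V × V) :=
  (a * (5 * ‖x‖⁻¹ - 4 * (saddle x ^ 2 * ‖x‖⁻¹ ^ 5))) • J x +
    (9 * (saddle x * ‖x‖⁻¹ ^ 3) - 20 * (saddle x ^ 3 * ‖x‖⁻¹ ^ 7)) • x

theorem contDiffAt_coneField (a : ℝ) {x : WithLp 2 (V × V)} (hx : x ≠ 0) :
    ContDiffAt ℝ 1 (coneField a) x := by
  have hI : ContDiffAt ℝ 1 (fun x : WithLp 2 (V × V) => ‖x‖⁻¹) x :=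
    (contDiffAt_norm ℝ hx).inv (norm_ne_zero_iff.2 hx)
  have hD : ContDiffAt ℝ 1 (saddle (V := V)) x := contDiff_saddle.contDiffAt.of_le (by simp)
  have hJ : ContDiffAt ℝ 1 (fun x => J x) x := (halfReflection V).contDiff.contDiffAt
  unfold coneField
  exact ((contDiffAt_const.mul ((contDiffAt_const.mul hI).sub
    (contDiffAt_const.mul ((hD.pow 2).mul (hI.pow 5))))).smul hJ).add
    (((contDiffAt_const.mul (hD.mul (hI.pow 3))).sub
      (contDiffAt_const.mul ((hD.pow 3).mul (hI.pow 7)))).smul contDiffAt_id)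

theorem norm_coneField_le {a : ℝ} (ha : 0 ≤ a) (x : WithLp 2 (V × V)) :
    ‖coneField a x‖ ≤ 5 * a + 9 := by
  by_cases hx : x = 0
  · simp only [coneField, hx, map_zero, smul_zero, add_zero, norm_zero]
    positivity
  have hN : 0 < ‖x‖ := norm_pos_iff.2 hx
  set z := saddle x * ‖x‖⁻¹ ^ 2 with hz
  have hz1 : |z| ≤ 1 / 2 := by
    rw [hz, abs_mul, abs_of_nonneg (a := ‖x‖⁻¹ ^ 2) (by positivity), inv_pow, ← div_eq_mul_inv,
      div_le_iff₀ (by positivity)]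
    linarith [abs_saddle_le x]
  have hz2 : z ^ 2 ≤ 1 / 4 := by
    rw [← sq_abs]
    nlinarith [abs_nonneg z]
  refine (norm_add_le _ _).trans (add_le_add ?_ ?_)
  · have h1 : a * (5 * ‖x‖⁻¹ - 4 * (saddle x ^ 2 * ‖x‖⁻¹ ^ 5)) * ‖x‖ = a * (5 - 4 * z ^ 2) := by
      rw [hz]
      field_simp
    have h2 : ‖a * (5 * ‖x‖⁻¹ - 4 * (saddle x ^ 2 * ‖x‖⁻¹ ^ 5))‖ * ‖x‖ = |a * (5 - 4 * z ^ 2)| := by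
      rw [← h1, abs_mul, abs_norm, Real.norm_eq_abs]
    rw [norm_smul, norm_halfReflection, h2, abs_of_nonneg (mul_nonneg ha (by linarith))]
    nlinarith [mul_nonneg ha (sq_nonneg z)]
  · have h1 : (9 * (saddle x * ‖x‖⁻¹ ^ 3) - 20 * (saddle x ^ 3 * ‖x‖⁻¹ ^ 7)) * ‖x‖ =
        z * (9 - 20 * z ^ 2) := by
      rw [hz]
      field_simp
    have h2 : ‖9 * (saddle x * ‖x‖⁻¹ ^ 3) - 20 * (saddle x ^ 3 * ‖x‖⁻¹ ^ 7)‖ * ‖x‖ =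
        |z * (9 - 20 * z ^ 2)| := by
      rw [← h1, abs_mul, abs_norm, Real.norm_eq_abs]
    rw [norm_smul, h2, abs_mul]
    have h3 : |9 - 20 * z ^ 2| ≤ 9 := by
      rw [abs_le]
      constructor <;> nlinarith [sq_nonneg z]
    nlinarith [abs_nonneg z, abs_nonneg (9 - 20 * z ^ 2)]

/-- The cone field is divergence free off the origin when `a = (dim - 1) / 2`. -/
theorem trace_fderiv_coneField [FiniteDimensional ℝ V] {a : ℝ}
    (ha : (Module.finrank ℝ (WithLp 2 (V × V)) : ℝ) = 2 * a + 1) {x : WithLp 2 (V × V)}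
    (hx : x ≠ 0) : LinearMap.trace ℝ (WithLp 2 (V × V)) (fderiv ℝ (coneField a) x) = 0 := by
  have hI := hasFDerivAt_norm_inv hx
  have hD := hasFDerivAt_saddle x
  have hA := ((hI.const_mul 5).sub (((hD.pow 2).mul (hI.pow 5)).const_mul 4)).const_mul a
  have hB := ((hD.mul (hI.pow 3)).const_mul 9).sub (((hD.pow 3).mul (hI.pow 7)).const_mul 20)
  have hX := (hA.smul (halfReflection V).hasFDerivAt).add (hB.smul (hasFDerivAt_id x))
  have hX' : HasFDerivAt (coneField a) _ x := hX
  have hN : ‖x‖ ≠ 0 := norm_ne_zero_iff.2 hx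
  have htr := trace_halfReflection (V := V)
  have hxx : ⟪x, x⟫ = ‖x‖ ^ 2 := real_inner_self_eq_norm_sq x
  have hJJ : ⟪J x, J x⟫ = ‖x‖ ^ 2 := by rw [inner_halfReflection_halfReflection, hxx]
  have hxJ : ⟪x, J x⟫ = 2 * saddle x := by rw [saddle]; ring
  have hJx : ⟪J x, x⟫ = 2 * saddle x := by rw [inner_halfReflection_comm, hxJ]
  have hrank : ∀ (f : WithLp 2 (V × V) →L[ℝ] ℝ) (y : WithLp 2 (V × V)),
      LinearMap.trace ℝ (WithLp 2 (V × V))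
        (f.smulRight y : WithLp 2 (V × V) →L[ℝ] WithLp 2 (V × V)) = f y :=
    fun f y => LinearMap.trace_smulRight (f : WithLp 2 (V × V) →ₗ[ℝ] ℝ) y
  have hid : LinearMap.trace ℝ (WithLp 2 (V × V)) (ContinuousLinearMap.id ℝ (WithLp 2 (V × V))) =
      Module.finrank ℝ (WithLp 2 (V × V)) := LinearMap.trace_id ℝ _
  rw [hX'.fderiv]
  simp only [ContinuousLinearMap.toLinearMap_add, ContinuousLinearMap.toLinearMap_smul, map_add,
    map_smul, htr, hrank, hid]
  simp only [sub_apply, add_apply, smul_apply, innerSL_apply_apply, id, Pi.sub_apply,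
    Pi.mul_apply, hxx, hJJ, hxJ, hJx, smul_eq_mul, nsmul_eq_mul, ha]
  push_cast
  field_simp
  ring

/-- The cone `(|x₂|² - |x₁|²) / (√2 |x|)` over an arbitrary inner product space. -/
noncomputable def normCone (x : WithLp 2 (V × V)) : ℝ := √2 * (saddle x * ‖x‖⁻¹)

theorem gradient_normCone [FiniteDimensional ℝ V] {x : WithLp 2 (V × V)} (hx : x ≠ 0) :
    ∇ normCone x = (√2 * ‖x‖⁻¹) • (J x - (saddle x * ‖x‖⁻¹ ^ 2) • x) := by
  apply HasGradientAt.gradient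
  rw [hasGradientAt_iff_hasFDerivAt]
  have h := ((hasFDerivAt_saddle x).mul (hasFDerivAt_norm_inv hx)).const_mul √2
  refine HasFDerivAt.congr_fderiv (f' := _) h ?_
  ext v
  simp only [smul_apply, add_apply, innerSL_apply_apply, smul_eq_mul,
    InnerProductSpace.toDual_apply_apply, real_inner_smul_left, inner_sub_left]
  ring

/-- The cone is homogeneous of degree one, `⟨x / |x|, J x⟩ / √2`. -/
theorem lipschitzWith_normCone : LipschitzWith 3 (normCone (V := V)) := by
  refine LipschitzWith.of_dist_le_mul fun x y => ?_
  rw [Real.dist_eq, dist_eq_norm]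
  set X := ‖x‖⁻¹ • x with hX
  set Y := ‖y‖⁻¹ • y with hY
  have hxX : ‖x‖ • X = x := by
    by_cases h : x = 0
    · simp [h]
    · rw [hX, smul_inv_smul₀ (norm_ne_zero_iff.2 h)]
  have hyY : ‖y‖ • Y = y := by
    by_cases h : y = 0
    · simp [h]
    · rw [hY, smul_inv_smul₀ (norm_ne_zero_iff.2 h)]
  have hY1 : ‖Y‖ ≤ 1 := by
    rw [hY, norm_smul, norm_inv, norm_norm]
    exact inv_mul_le_one
  have h1 : ‖x‖ * ‖X - Y‖ ≤ 2 * ‖x - y‖ := by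
    have e : ‖x‖ • (X - Y) = (x - y) + (‖y‖ - ‖x‖) • Y := by
      rw [smul_sub, hxX, sub_smul, hyY]
      abel
    calc ‖x‖ * ‖X - Y‖ = ‖‖x‖ • (X - Y)‖ := by rw [norm_smul, norm_norm]
      _ ≤ ‖x - y‖ + |‖y‖ - ‖x‖| * ‖Y‖ := by
        rw [e]
        refine (norm_add_le _ _).trans_eq ?_
        rw [norm_smul, Real.norm_eq_abs]
      _ ≤ ‖x - y‖ + ‖x - y‖ * 1 := by
        refine add_le_add le_rfl (mul_le_mul ?_ hY1 (norm_nonneg _) (norm_nonneg _))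
        rw [norm_sub_rev x y]
        exact abs_norm_sub_norm_le y x
      _ = 2 * ‖x - y‖ := by ring
  have h2 : |⟪X - Y, J x⟫| ≤ 2 * ‖x - y‖ := by
    refine (abs_real_inner_le_norm _ _).trans ?_
    rw [norm_halfReflection, mul_comm]
    exact h1
  have h3 : |⟪Y, J (x - y)⟫| ≤ ‖x - y‖ := by
    refine (abs_real_inner_le_norm _ _).trans ?_
    rw [norm_halfReflection]
    exact mul_le_of_le_one_left (norm_nonneg _) hY1
  have hc : ∀ v : WithLp 2 (V × V), normCone v = √2 / 2 * ⟪‖v‖⁻¹ • v, J v⟫ := by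
    intro v
    rw [normCone, saddle, real_inner_smul_left]
    ring
  have h4 : normCone x - normCone y = √2 / 2 * (⟪X - Y, J x⟫ + ⟪Y, J (x - y)⟫) := by
    rw [hc, hc, map_sub, inner_sub_left, inner_sub_right]
    ring
  have h5 : √2 / 2 ≤ 1 := by
    rw [div_le_one two_pos]
    exact Real.sqrt_le_iff.2 ⟨by norm_num, by norm_num⟩
  rw [h4, abs_mul, abs_of_nonneg (by positivity : 0 ≤ √2 / 2)]
  calc √2 / 2 * |⟪X - Y, J x⟫ + ⟪Y, J (x - y)⟫|
      ≤ 1 * (2 * ‖x - y‖ + ‖x - y‖) :=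
        mul_le_mul h5 ((abs_add_le _ _).trans (add_le_add h2 h3)) (abs_nonneg _) zero_le_one
    _ = (3 : ℝ≥0) * ‖x - y‖ := by push_cast; ring

/-- On the second factor the cone is a multiple of the norm. -/
theorem not_differentiableAt_normCone [Nontrivial V] :
    ¬ DifferentiableAt ℝ (normCone (V := V)) 0 := by
  intro hd
  obtain ⟨e, he⟩ := exists_norm_eq V zero_le_one
  set v : WithLp 2 (V × V) := WithLp.toLp 2 (0, e) with hv
  have hline : DifferentiableAt ℝ (fun t : ℝ => t • v) 0 := by fun_prop
  have h1 : DifferentiableAt ℝ (fun t : ℝ => normCone (t • v)) 0 :=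
    DifferentiableAt.comp (g := normCone (V := V)) (0 : ℝ) (by rwa [zero_smul]) hline
  have hvn : ‖v‖ = 1 := by rw [hv, WithLp.norm_toLp_snd, he]
  have h2 : ∀ t : ℝ, normCone (t • v) = √2 / 2 * |t| := by
    intro t
    rw [normCone, saddle, inner_self_halfReflection, norm_smul, hvn]
    simp only [hv, WithLp.smul_fst, WithLp.smul_snd, WithLp.toLp_fst, WithLp.toLp_snd, smul_zero,
      norm_zero, norm_smul, he, Real.norm_eq_abs, mul_one]
    by_cases ht : t = 0
    · simp [ht]
    · have := abs_ne_zero.2 ht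
      field_simp
      ring
  simp only [h2] at h1
  refine not_differentiableAt_abs_zero ?_
  have h3 := h1.const_mul (√2 / 2)⁻¹
  have h4 : √2 / 2 ≠ 0 := by positivity
  simpa only [inv_mul_cancel_left₀ h4] using h3

/-- On the circle `s² + t² = 1` the profile splits along the two terms of the cone field. -/
theorem profilePoly_of_sq_add_sq {a s t : ℝ} (h : s ^ 2 + t ^ 2 = 1) :
    profilePoly a s = a * (5 - 4 * (s * t) ^ 2) * s +
      s * t * (9 - 20 * (s * t) ^ 2) * t - s ^ 3 / 10 := by
  have ht : t ^ 2 = 1 - s ^ 2 := by linarith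
  have e : a * (5 - 4 * (s * t) ^ 2) * s + s * t * (9 - 20 * (s * t) ^ 2) * t - s ^ 3 / 10 =
      a * (5 - 4 * (s ^ 2 * t ^ 2)) * s + s * t ^ 2 * (9 - 20 * (s ^ 2 * t ^ 2)) - s ^ 3 / 10 := by
    ring
  rw [e, ht, profilePoly]
  ring

/-- Along the cone the gradient of the integrand is the divergence-free cone field. Here
`s, t = (|x₂| ∓ |x₁|) / (√2 |x|)` are the cube roots of the rotated norms of the two halves of the
gradient of the cone. -/
theorem gradient_integrand_gradient_normCone [FiniteDimensional ℝ V] {a : ℝ}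
    {F : WithLp 2 (V × V) → ℝ}
    (hF : ∀ p : WithLp 2 (V × V), p.fst ≠ 0 → p.snd ≠ 0 → ∀ s t : ℝ, s ^ 2 + t ^ 2 = 1 →
      (‖p.snd‖ - ‖p.fst‖) / 2 = s ^ 3 → (‖p.snd‖ + ‖p.fst‖) / 2 = t ^ 3 →
      ∇ F p = WithLp.toLp 2
        (((profilePoly a t - profilePoly a s) / 2 / ‖p.fst‖ + 1 / 20) • p.fst,
          ((profilePoly a t + profilePoly a s) / 2 / ‖p.snd‖ + 1 / 20) • p.snd))
    {x : WithLp 2 (V × V)} (h₁ : x.fst ≠ 0) (h₂ : x.snd ≠ 0) :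
    ∇ F (∇ normCone x) = (√2 / 2) • coneField a x := by
  have hx : x ≠ 0 := fun h => h₁ (by rw [h, WithLp.zero_fst])
  have hN : 0 < ‖x‖ := norm_pos_iff.2 hx
  have hr : 0 < ‖x.fst‖ := norm_pos_iff.2 h₁
  have hq : 0 < ‖x.snd‖ := norm_pos_iff.2 h₂
  set I := ‖x‖⁻¹ with hI
  have hI0 : 0 < I := inv_pos.2 hN
  set a₁ := I * ‖x.fst‖ with ha₁
  set a₂ := I * ‖x.snd‖ with ha₂
  have ha₁0 : 0 < a₁ := by positivity
  have ha₂0 : 0 < a₂ := by positivity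
  have haa : a₁ ^ 2 + a₂ ^ 2 = 1 := by
    rw [ha₁, ha₂, mul_pow, mul_pow, ← mul_add, ← WithLp.prod_norm_sq_eq_of_L2, hI]
    field_simp
  set c := √2 / 2 with hc
  have hc0 : 0 < c := by positivity
  have h2c : √2 = 2 * c := by rw [hc]; ring
  have hcc : c ^ 2 = 1 / 2 := by
    rw [hc, div_pow, Real.sq_sqrt zero_le_two]
    norm_num
  set s := c * (a₂ - a₁) with hs
  set t := c * (a₂ + a₁) with ht
  have hst : s ^ 2 + t ^ 2 = 1 := by
    have : s ^ 2 + t ^ 2 = c ^ 2 * (2 * (a₁ ^ 2 + a₂ ^ 2)) := by rw [hs, ht]; ring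
    rw [this, hcc, haa]
    norm_num
  set z := s * t with hz
  have hzD : saddle x * I ^ 2 = z := by
    have : z = c ^ 2 * (a₂ ^ 2 - a₁ ^ 2) := by rw [hz, hs, ht]; ring
    rw [this, hcc, saddle, inner_self_halfReflection, ha₁, ha₂]
    ring
  -- As `s² + t² = 1`, the product `z = s t` is at most `1/2` in absolute value.
  have hz1 : 0 < 1 + z := by nlinarith [sq_nonneg (s + t)]
  have hz2 : 0 < 1 - z := by nlinarith [sq_nonneg (s - t)]
  set p := ∇ normCone x with hp
  have hp1 : p.fst = (-(2 * c * I * (1 + z))) • x.fst := by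
    rw [hp, gradient_normCone hx, ← hI, hzD, h2c]
    simp only [WithLp.smul_fst, WithLp.sub_fst, halfReflection_fst]
    module
  have hp2 : p.snd = (2 * c * I * (1 - z)) • x.snd := by
    rw [hp, gradient_normCone hx, ← hI, hzD, h2c]
    simp only [WithLp.smul_snd, WithLp.sub_snd, halfReflection_snd]
    module
  have hP : ‖p.fst‖ = 2 * c * (1 + z) * a₁ := by
    rw [hp1, norm_smul, norm_neg, Real.norm_of_nonneg (by positivity), ha₁]
    ring
  have hQ : ‖p.snd‖ = 2 * c * (1 - z) * a₂ := by
    rw [hp2, norm_smul, Real.norm_of_nonneg (by positivity), ha₂]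
    ring
  have hs3 : (‖p.snd‖ - ‖p.fst‖) / 2 = s ^ 3 := by
    have e : (‖p.snd‖ - ‖p.fst‖) / 2 = s - z * t := by rw [hP, hQ, hs, ht]; ring
    rw [e, hz]
    linear_combination (-s) * hst
  have ht3 : (‖p.snd‖ + ‖p.fst‖) / 2 = t ^ 3 := by
    have e : (‖p.snd‖ + ‖p.fst‖) / 2 = t - z * s := by rw [hP, hQ, hs, ht]; ring
    rw [e, hz]
    linear_combination (-t) * hst
  have hp1' : p.fst ≠ 0 := by
    rw [← norm_ne_zero_iff, hP]
    positivity
  have hp2' : p.snd ≠ 0 := by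
    rw [← norm_ne_zero_iff, hQ]
    positivity
  set α := a * (5 - 4 * z ^ 2) with hα
  set β := z * (9 - 20 * z ^ 2) with hβ
  have hvs : profilePoly a s = α * s + β * t - s ^ 3 / 10 := profilePoly_of_sq_add_sq hst
  have hvt : profilePoly a t = α * t + β * s - t ^ 3 / 10 := by
    rw [profilePoly_of_sq_add_sq ((add_comm _ _).trans hst), mul_comm t s]
  have hcoef₁ : (profilePoly a t - profilePoly a s) / 2 / ‖p.fst‖ + 1 / 20 =
      (α - β) / (2 * (1 + z)) := by
    have e : profilePoly a t - profilePoly a s = (α - β) * (2 * c * a₁) - ‖p.fst‖ / 10 := by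
      rw [hvs, hvt, ← hs3, ← ht3, hs, ht]
      ring
    rw [e, hP]
    field_simp
    ring
  have hcoef₂ : (profilePoly a t + profilePoly a s) / 2 / ‖p.snd‖ + 1 / 20 =
      (α + β) / (2 * (1 - z)) := by
    have e : profilePoly a t + profilePoly a s = (α + β) * (2 * c * a₂) - ‖p.snd‖ / 10 := by
      rw [hvs, hvt, ← hs3, ← ht3, hs, ht]
      ring
    rw [e, hQ]
    field_simp
    ring
  have hA : a * (5 * ‖x‖⁻¹ - 4 * (saddle x ^ 2 * ‖x‖⁻¹ ^ 5)) = I * α := by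
    rw [hα, ← hzD, ← hI]
    ring
  have hB : 9 * (saddle x * ‖x‖⁻¹ ^ 3) - 20 * (saddle x ^ 3 * ‖x‖⁻¹ ^ 7) = I * β := by
    rw [hβ, ← hzD, ← hI]
    ring
  rw [hF p hp1' hp2' s t hst hs3 ht3, hcoef₁, hcoef₂, hp1, hp2, smul_smul, smul_smul, coneField, hA,
    hB]
  apply WithLp.ofLp_injective 2
  refine Prod.ext ?_ ?_
  · change ((α - β) / (2 * (1 + z)) * -(2 * c * I * (1 + z))) • x.fst =
      c • ((I * α) • -x.fst + (I * β) • x.fst)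
    rw [smul_neg, ← neg_smul, ← add_smul, smul_smul]
    congr 1
    field_simp
    ring
  · change ((α + β) / (2 * (1 - z)) * (2 * c * I * (1 - z))) • x.snd =
      c • ((I * α) • x.snd + (I * β) • x.snd)
    rw [← add_smul, smul_smul]
    congr 1
    field_simp

end Cone

theorem coneFunction_eq_normCone (n : ℕ) :
    coneFunction n = normCone (V := EuclideanSpace ℝ (Fin n)) := by
  ext x
  rw [coneFunction, normCone, saddle, inner_self_halfReflection]
  have h : (√2)⁻¹ = √2 / 2 := by
    rw [inv_eq_one_div, div_eq_div_iff (by positivity) two_ne_zero, Real.mul_self_sqrt zero_le_two,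
      one_mul]
  rw [div_eq_mul_inv, mul_inv, h]
  ring

theorem finrank_doubleSpace (n : ℕ) : Module.finrank ℝ (DoubleSpace n) = 2 * n := by
  rw [LinearEquiv.finrank_eq (WithLp.linearEquiv 2 ℝ _), Module.finrank_prod,
    finrank_euclideanSpace_fin]
  ring

/-- Almost every point has both halves nonzero. -/
theorem ae_fst_ne_zero_and_snd_ne_zero {n : ℕ} (hn : n ≠ 0) :
    ∀ᵐ x : DoubleSpace n, x.fst ≠ 0 ∧ x.snd ≠ 0 := by
  have : NeZero n := ⟨hn⟩
  obtain ⟨e, he⟩ := exists_ne (0 : EuclideanSpace ℝ (Fin n))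
  have h1 : ∀ᵐ x : DoubleSpace n, x.fst ≠ 0 := by
    refine compl_mem_ae_iff.2 (Measure.addHaar_submodule volume
      (LinearMap.ker (WithLp.fstL 2 ℝ (EuclideanSpace ℝ (Fin n))
        (EuclideanSpace ℝ (Fin n))).toLinearMap)
      fun h => he ?_)
    have : WithLp.toLp 2 (e, 0) ∈ LinearMap.ker (WithLp.fstL 2 ℝ (EuclideanSpace ℝ (Fin n))
      (EuclideanSpace ℝ (Fin n))).toLinearMap := h ▸ Submodule.mem_top
    exact this
  have h2 : ∀ᵐ x : DoubleSpace n, x.snd ≠ 0 := by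
    refine compl_mem_ae_iff.2 (Measure.addHaar_submodule volume
      (LinearMap.ker (WithLp.sndL 2 ℝ (EuclideanSpace ℝ (Fin n))
        (EuclideanSpace ℝ (Fin n))).toLinearMap)
      fun h => he ?_)
    have : WithLp.toLp 2 (0, e) ∈ LinearMap.ker (WithLp.sndL 2 ℝ (EuclideanSpace ℝ (Fin n))
      (EuclideanSpace ℝ (Fin n))).toLinearMap := h ▸ Submodule.mem_top
    exact this
  exact h1.and h2

theorem measurable_coneField (a : ℝ) (n : ℕ) :
    Measurable (coneField a : DoubleSpace n → DoubleSpace n) := by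
  have hS : Measurable (saddle (V := EuclideanSpace ℝ (Fin n))) :=
    contDiff_saddle.continuous.measurable
  have hJ : Measurable (halfReflection (EuclideanSpace ℝ (Fin n))) :=
    (halfReflection _).continuous.measurable
  have hI : Measurable fun x : DoubleSpace n => ‖x‖⁻¹ := measurable_norm.inv
  exact ((((hI.const_mul 5).sub (((hS.pow_const 2).mul (hI.pow_const 5)).const_mul 4)).const_mul
    a).smul hJ).add ((((hS.mul (hI.pow_const 3)).const_mul 9).sub
      (((hS.pow_const 3).mul (hI.pow_const 7)).const_mul 20)).smul measurable_id)

theorem theorem2p2 (n : ℕ) (hn : 2 ≤ n) :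
    (∃ F : DoubleSpace n → ℝ,
      (∃ m : ℝ, 0 < m ∧ StrongConvexOn Set.univ m F) ∧
      ContDiff ℝ 1 F ∧
      ContDiffOn ℝ ∞ F (degeneracySet F)ᶜ ∧
      degeneracySet F =
        {p : DoubleSpace n | ‖p.fst‖ = ‖p.snd‖} ∩ Metric.sphere (0 : DoubleSpace n) √2 ∧
      IsLipschitzWeakSolution F (coneFunction n) ∧
      IsLipschitzMinimizer F (coneFunction n)) ∧
    (∃ K : ℝ≥0, LipschitzWith K (coneFunction n)) ∧
    ¬ ContDiffOn ℝ 1 (coneFunction n) (Metric.ball (0 : DoubleSpace n) 1) := by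
  have hn' : (2 : ℝ) ≤ n := by exact_mod_cast hn
  have : NeZero n := ⟨by omega⟩
  obtain ⟨F, ⟨m, hm, hsc⟩, hF1, hFs, hdeg, hgrad⟩ :=
    exists_integrand (V := EuclideanSpace ℝ (Fin n)) (a := n - 1 / 2) (by linarith)
  rw [coneFunction_eq_normCone]
  have hLip := lipschitzWith_normCone (V := EuclideanSpace ℝ (Fin n))
  have hsol : IsLipschitzWeakSolution F (normCone (V := EuclideanSpace ℝ (Fin n))) := by
    refine ⟨hLip.memW1Infty isOpen_ball isBounded_ball, fun φ hφ => ?_⟩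
    have h1 : ∫ x in ball (0 : DoubleSpace n) 1,
        ⟪∇ F (weakGrad (ball (0 : DoubleSpace n) 1) normCone x), ∇ φ x⟫ =
        ∫ x in ball (0 : DoubleSpace n) 1, √2 / 2 * ⟪coneField (n - 1 / 2 : ℝ) x, ∇ φ x⟫ := by
      refine integral_congr_ae ?_
      filter_upwards [hLip.weakGrad_ae_eq isOpen_ball,
        ae_restrict_of_ae (ae_fst_ne_zero_and_snd_ne_zero (n := n) (by omega))] with x hx hx0
      rw [hx, gradient_integrand_gradient_normCone hgrad hx0.1 hx0.2, real_inner_smul_left]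
    rw [h1, integral_const_mul, setIntegral_eq_integral_of_forall_compl_eq_zero fun x hx => by
      rw [hφ.gradient_eq_zero hx, inner_zero_right]]
    have hdim := finrank_doubleSpace n
    have hdim2 : 2 ≤ Module.finrank ℝ (DoubleSpace n) := by omega
    rw [integral_inner_gradient_eq_zero hdim2 (measurable_coneField _ n)
      (norm_coneField_le (by linarith)) (fun x hx => contDiffAt_coneField _ hx)
      (fun x hx => trace_fderiv_coneField (by rw [hdim]; push_cast; ring) hx) hφ.contDiff
      hφ.hasCompactSupport, mul_zero]
  have hconv : ConvexOn ℝ univ F :=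
    (hsc.strictConvexOn hm).convexOn
  refine ⟨⟨F, ⟨m, hm, hsc⟩, hF1, hFs, ?_, hsol, hsol.isLipschitzMinimizer hconv hF1 hLip⟩,
    ⟨3, hLip⟩, fun h => ?_⟩
  · rw [hdeg, setOf_norm_eq_inter_sphere]
  · exact not_differentiableAt_normCone ((h.contDiffAt
      (isOpen_ball.mem_nhds (mem_ball_self one_pos))).differentiableAt one_ne_zero)
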